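/- Let $k\ge 3$. For a finite nonempty subset $S$ of an abelian group, an exact $r$-coloring of $S$ is a surjective map $c:S\to\{1,\dots,r\}$, and a $k$-term arithmetic progression in $S$ is a set of $k$ distinct elements of $S$ of the form $a,a+d,\dots,a+(k-1)d$; it is rainbow under $c$ if its terms have $k$ distinct colors. Let $\operatorname{aw}(S,k)$ be the smallest $r\ge 1$ such that every exact $r$-coloring of $S$ contains a rainbow $k$-term arithmetic progression (so $\operatorname{aw}(S,k)=|S|+1$ if $|S|<k$). For an integer $n\ge 2$ let $f_2(n)$ be $1$ if $n$ is even and $0$ if $n$ is odd, and let $f_3(n)$ and $f_4(n)$ be the numbers of odd prime factors $p$ of $n$, counted with multiplicity, with $\operatorname{aw}(\mathbb{Z}_p,3)=3$ and with $\operatorname{aw}(\mathbb{Z}_p,3)=4$, respectively. Let $Q_4=\{17,31,41,43,73,89,97\}$, and let $Q_3$ be the set of all odd primes less than $100$ that are not in $Q_4$. Theorem. (1) For every prime $p$, $3\le \operatorname{aw}(\mathbb{Z}_p,3)\le 4$. (2) For every integer $n\ge 2$, $\operatorname{aw}(\mathbb{Z}_n,3)=2+f_2(n)+f_3(n)+2f_4(n)$.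 (3) For every prime $p<100$, $\operatorname{aw}(\mathbb{Z}_p,3)=4$ if and only if $p\in Q_4$. Moreover, for every integer $n\ge 2$ all of whose prime factors are less than $100$, $f_4(n)$ is the number of odd prime factors of $n$ in $Q_4$ and $f_3(n)$ is the number of odd prime factors of $n$ in $Q_3$, both counted with multiplicity. -/

import Mathlib

namespace AntiVdW

/-- `x 0, …, x (k-1)` are the `k` distinct terms `a, a + d, …, a + (k-1)d` of a `k`-term
arithmetic progression in the abelian group `G`. -/
def IsAP {G : Type*} [AddCommGroup G] {k : ℕ} (x : Fin k → G) : Prop :=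
  Function.Injective x ∧ ∃ a d : G, ∀ i : Fin k, x i = a + (i : ℕ) • d

/-- The coloring `c` of `S` has a rainbow `k`-term arithmetic progression: one contained in `S`
whose terms receive `k` distinct colors. -/
def HasRainbowAP {G : Type*} [AddCommGroup G] {S : Set G} {r : ℕ} (c : S → Fin r) (k : ℕ) : Prop :=
  ∃ x : Fin k → S, IsAP (fun i => (x i : G)) ∧ Function.Injective (fun i => c (x i))

/-- The anti-van der Waerden number `aw(S, k)` of a finite nonempty set `S`: the smallest number
`r ≥ 1` of colors such that every exact (surjective) `r`-coloring of `S` has a rainbow `k`-term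
arithmetic progression.  The set of such `r` contains `|S| + 1`, as there is no exact coloring
of `S` with that many colors. -/
noncomputable def aw {G : Type*} [AddCommGroup G] (S : Set G) (k : ℕ) : ℕ :=
  sInf {r : ℕ | 1 ≤ r ∧ ∀ c : S → Fin r, Function.Surjective c → HasRainbowAP c k}

/-- `aw(ℤ_n, k)`. -/
noncomputable def awZ (n k : ℕ) : ℕ := aw (Set.univ : Set (ZMod n)) k

/-- `1` if `n` is even and `0` if `n` is odd. -/
def f₂ (n : ℕ) : ℕ := if Even n then 1 else 0

/-- The number, with multiplicity, of odd prime factors `p` of `n` with `aw(ℤ_p, 3) = 3`. -/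
noncomputable def f₃ (n : ℕ) : ℕ :=
  n.primeFactorsList.countP (fun p => Odd p ∧ awZ p 3 = 3)

/-- The number, with multiplicity, of odd prime factors `p` of `n` with `aw(ℤ_p, 3) = 4`. -/
noncomputable def f₄ (n : ℕ) : ℕ :=
  n.primeFactorsList.countP (fun p => Odd p ∧ awZ p 3 = 4)

/-- The primes below `100` for which the value `4` is claimed. -/
def Q₄ : Finset ℕ := {17, 31, 41, 43, 73, 89, 97}

/-- The odd primes below `100` that are not in `Q₄`. -/
def Q₃ : Finset ℕ := {p ∈ Finset.range 100 | p.Prime ∧ Odd p ∧ p ∉ Q₄}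

end AntiVdW

/-! Let M(n) be the largest number of colors in a coloring of ℤ_n without rainbow three-term
progressions. Merging colors keeps a coloring rainbow-free, so aw(ℤ_n, 3) = M(n) + 1. Colorings of
ℤ_n are handled as n-periodic colorings of ℤ.

The formula rests on M(pm) = M(p) + M(m) - 1 for odd primes p. Upper bound (`ncard_range_le`): among
the residue classes modulo m, one richest in colors has at most M(p) colors, each other class adds
at most one new color, and recording the new colors gives a rainbow-free coloring of period m. Lower
bound (`IsMaxColors.mul`): color the multiples of p by an optimal coloring for m and the rest by an
optimal coloring for p. This requires 0 to have a color of its own in the latter.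

That requirement is met by `exists_singleton`: a rainbow-free coloring of ℤ_p with exactly three
colors uses some color once. For each difference d ≠ 0 some color is dominant: the other two are
never at distance d. The smallest class B is never dominant, so the difference sets B - R and B - G
are disjoint and omit 0, and Cauchy–Davenport leaves room only for |B| = 1. Four colors would
produce two colors used once, which is impossible; hence M(p) is 2 or 3.

With the color used once placed at 0, the other classes are stable under doubling and negation. Thus
M(p) = 3, for odd p, exactly when 2 and -1 fail to generate the units, a finite check for p < 100.
For powers of two, M = 2 by induction on parity classes. -/

namespace AntiVdW

/-! ### Color patterns at consecutive integers -/

/-- A coloring of an abelian group without rainbow three-term arithmetic progressions. -/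
def RainbowFree {G α : Type*} [AddCommGroup G] (c : G → α) : Prop :=
  ∀ x y z : G, x + z = y + y → c x = c y ∨ c y = c z ∨ c x = c z

theorem RainbowFree.comp {G α β : Type*} [AddCommGroup G] {c : G → α} (h : RainbowFree c)
    (f : α → β) : RainbowFree (f ∘ c) := by
  intro x y z e
  rcases h x y z e with h | h | h <;> simp [h]

/-- Pulling back a rainbow-free coloring along `i ↦ a + f i`. -/
theorem RainbowFree.comp_affine {G H α : Type*} [AddCommGroup G] [AddCommGroup H] {c : G → α}
    (h : RainbowFree c) (a : G) (f : H →+ G) : RainbowFree (fun i => c (a + f i)) := by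
  intro x y z e
  refine h _ _ _ ?_
  have := congrArg f e
  rw [map_add, map_add] at this
  calc a + f x + (a + f z) = a + a + (f x + f z) := by abel
    _ = _ := by rw [this]; abel

theorem RainbowFree.progression {G α : Type*} [AddCommGroup G] {c : G → α} (h : RainbowFree c)
    (a d : G) : RainbowFree (fun i : ℤ => c (a + i • d)) :=
  h.comp_affine a (zmultiplesHom G d)

/-- The two neighbours, inside a gap, of the ends of a gap of a color class have the same color. -/
theorem RainbowFree.gap {α : Type*} {c : ℤ → α} (h : RainbowFree c) {q : ℤ} (hq : 2 ≤ q)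
    (h0 : c q = c 0) (hin : ∀ m, 0 < m → m < q → c m ≠ c 0) : c 1 = c (q - 1) := by
  by_contra hne
  -- Progressions starting at 0 or ending at q show that, inside the gap, color is preserved by
  -- doubling the distance to either end.
  have hd : ∀ m, 0 < m → 2 * m < q → c (2 * m) = c m := by
    intro m h1 h2
    have := h 0 m (2 * m) (by omega)
    have := hin m (by omega) (by omega)
    have := hin (2 * m) (by omega) (by omega)
    grind
  have hu : ∀ m, 0 < m → 2 * m < q → c (q - 2 * m) = c (q - m) := by
    intro m h1 h2
    have := h (q - 2 * m) (q - m) q (by omega)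
    have := hin (q - m) (by omega) (by omega)
    have := hin (q - 2 * m) (by omega) (by omega)
    grind
  have h1 := hin 1 (by omega) (by omega)
  have hq1 := hin (q - 1) (by omega) (by omega)
  obtain ⟨k, hk | hk⟩ := Int.even_or_odd' q
  · rcases eq_or_ne k 1 with rfl | hk1
    · exact hne (by rw [hk]; norm_num)
    have e2 : c 2 = c 1 := hd 1 (by omega) (by omega)
    have e3 : c (q - 2) = c (q - 1) := hu 1 (by omega) (by omega)
    have e4 : c (2 * (k - 1)) = c (k - 1) := hd (k - 1) (by omega) (by omega)
    rw [show 2 * (k - 1) = q - 2 by omega] at e4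
    -- The first progression leaves the colors of 0 and 2, the second those of q and k - 1; the
    -- assumption makes the colors of 2 and k - 1 differ. With -2 colored like 0, the progressions
    -- -2, m, 2m + 2 spread the color of 2 over all even points of the gap.
    have em : c (-2) = c 0 := by
      have a1 := h (-2) 0 2 (by omega)
      have a2 := h (-2) (k - 1) q (by omega)
      grind
    have key : ∀ n : ℕ, 2 * ((n : ℤ) + 1) < q → c (2 * ((n : ℤ) + 1)) = c 2 := by
      intro n
      induction n with
      | zero => intro _; simp
      | succ n ih =>
        intro hn
        push_cast at hn ⊢
        have i1 := ih (by omega)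
        have i2 := hd ((n : ℤ) + 1) (by omega) (by omega)
        have i3 := h (-2) ((n : ℤ) + 1) (2 * ((n : ℤ) + 1 + 1)) (by omega)
        have i4 := hin ((n : ℤ) + 1) (by omega) (by omega)
        have i5 := hin (2 * ((n : ℤ) + 1 + 1)) (by omega) (by omega)
        grind
    have := key (k - 2).toNat (by omega)
    rw [show 2 * (((k - 2).toNat : ℤ) + 1) = q - 2 by omega] at this
    grind
  · have e4 : c (2 * k) = c k := hd k (by omega) (by omega)
    rw [show 2 * k = q - 1 by omega] at e4
    have em : c (-1) = c 0 := by
      have a1 := h (-1) 0 1 (by omega)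
      have a2 := h (-1) k q (by omega)
      grind
    have key : ∀ n : ℕ, 0 < n → (n : ℤ) < q → c n = c 1 := by
      intro n
      induction n using Nat.strong_induction_on with
      | _ n ih =>
        intro hn hnq
        rcases eq_or_ne n 1 with rfl | hn1
        · simp
        have i1 := ih (n / 2) (by omega) (by omega) (by omega)
        rcases Nat.even_or_odd' n with ⟨m, rfl | rfl⟩
        · have i2 := hd m (by omega) (by omega)
          rw [show 2 * m / 2 = m by omega] at i1
          push_cast
          rw [i2, i1]
        · rw [show (2 * m + 1) / 2 = m by omega] at i1
          have i3 := h (-1) m ((2 * m + 1 : ℕ) : ℤ) (by push_cast; omega)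
          have i4 := hin m (by omega) (by omega)
          have i5 := hin ((2 * m + 1 : ℕ) : ℤ) (by omega) (by omega)
          grind
    have := key (q - 1).toNat (by omega) (by omega)
    rw [show (((q - 1).toNat : ℕ) : ℤ) = q - 1 by omega] at this
    exact hne this.symm

/-- `i` and `i + 1` have the two distinct colors other than `X`. -/
def Bichromatic (c : ℤ → Fin 3) (i : ℤ) (X : Fin 3) : Prop :=
  c i ≠ c (i + 1) ∧ c i ≠ X ∧ c (i + 1) ≠ X

theorem fin_three_cover : ∀ X Y Z a : Fin 3, X ≠ Y → X ≠ Z → Y ≠ Z → a = X ∨ a = Y ∨ a = Z := by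
  decide

theorem RainbowFree.shift {α : Type*} {c : ℤ → α} (h : RainbowFree c) (a : ℤ) :
    RainbowFree (fun i => c (a + i)) :=
  h.comp_affine a (AddMonoidHom.id ℤ)

/-- Induction on the length: in a shortest configuration every bichromatic pair strictly between i
and j has type X, so the color X cannot appear anywhere from i + 1 to j. This stretch is then a gap
of X bounded by i and j + 1, and `gap` demands equal colors at its two ends, which are Z and Y. -/
theorem RainbowFree.not_three_types_of_le {c : ℤ → Fin 3} (h : RainbowFree c) (n : ℕ) :
    ∀ i k j : ℤ, i < k → k < j → j - i ≤ n → ∀ X Y Z : Fin 3, X ≠ Y → X ≠ Z → Y ≠ Z →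
      Bichromatic c i Y → Bichromatic c k X → Bichromatic c j Z → False := by
  induction n with
  | zero => intros; omega
  | succ n ih =>
    intro i k j hik hkj hn X Y Z hXY hXZ hYZ hi hk hj
    have step : ∀ m, i < m → m < j → c m = c (m + 1) ∨ Bichromatic c m X := by
      intro m h1 h2
      by_contra! hcon
      obtain ⟨hne, hX⟩ := hcon
      have cover := fin_three_cover X Y Z
      have hW : Bichromatic c m Y ∨ Bichromatic c m Z := by
        unfold Bichromatic at *
        have := cover (c m) hXY hXZ hYZ
        have := cover (c (m + 1)) hXY hXZ hYZ
        grind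
      rcases hW with hW | hW
      · rcases lt_trichotomy m k with hm | hm | hm
        · exact ih m k j hm hkj (by push_cast at hn; omega) X Y Z hXY hXZ hYZ hW hk hj
        · exact hX (hm ▸ hk)
        · exact ih k m j hm h2 (by push_cast at hn; omega) Y X Z hXY.symm hYZ hXZ hk hW hj
      · rcases lt_trichotomy m k with hm | hm | hm
        · exact ih i m k h1 hm (by push_cast at hn; omega) Z Y X hYZ.symm hXZ.symm hXY.symm hi hW hk
        · exact hX (hm ▸ hk)
        · exact ih i k m hik hm (by push_cast at hn; omega) X Y Z hXY hXZ hYZ hi hk hW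
    have right : ∀ t : ℕ, k + t ≤ j → c (k + t) ≠ X := by
      intro t
      induction t with
      | zero => intro _; simpa using hk.2.1
      | succ t iht =>
        intro ht
        push_cast at ht ⊢
        have h1 := iht (by omega)
        rw [← add_assoc]
        rcases step (k + t) (by omega) (by omega) with h2 | h2
        · rwa [← h2]
        · exact h2.2.2
    have left : ∀ t : ℕ, i < k - t → c (k - t) ≠ X := by
      intro t
      induction t with
      | zero => intro _; simpa using hk.2.1
      | succ t iht =>
        intro ht
        push_cast at ht ⊢
        have h1 := iht (by omega)
        rcases step (k - (t + 1)) (by omega) (by omega) with h2 | h2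
        · rw [h2]; rwa [show k - ((t : ℤ) + 1) + 1 = k - t by omega]
        · exact h2.2.1
    have inner : ∀ m, i < m → m ≤ j → c m ≠ X := by
      intro m h1 h2
      rcases le_total k m with h3 | h3
      · have := right (m - k).toNat (by omega)
        rwa [show k + ((m - k).toNat : ℤ) = m by omega] at this
      · have := left (k - m).toNat (by omega)
        rwa [show k - ((k - m).toNat : ℤ) = m by omega] at this
    have hcov := fin_three_cover X Y Z
    have ci1 := inner (i + 1) (by omega) (by omega)
    have cj := inner j (by omega) (by omega)
    unfold Bichromatic at hi hj
    have ei : c i = X ∧ c (i + 1) = Z := by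
      have := hcov (c i) hXY hXZ hYZ
      have := hcov (c (i + 1)) hXY hXZ hYZ
      grind
    have ej : c (j + 1) = X ∧ c j = Y := by
      have := hcov (c j) hXY hXZ hYZ
      have := hcov (c (j + 1)) hXY hXZ hYZ
      grind
    have := (h.shift i).gap (q := j + 1 - i) (by omega)
      (by rw [show i + (j + 1 - i) = j + 1 by omega, add_zero, ei.1, ej.1])
      (fun m h1 h2 => by
        rw [add_zero, ei.1]
        exact inner _ (by omega) (by omega))
    rw [show i + (j + 1 - i - 1) = j by omega, ei.2, ej.2] at this
    exact hYZ this.symm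

/-- In a periodic rainbow-free three-coloring of `ℤ`, some pair of distinct colors never occurs at
consecutive integers. -/
theorem RainbowFree.not_three_types {c : ℤ → Fin 3} (h : RainbowFree c) {n : ℕ} (hn : n ≠ 0)
    (hp : Function.Periodic c (n : ℤ)) {X Y Z : Fin 3} (hXY : X ≠ Y) (hXZ : X ≠ Z) (hYZ : Y ≠ Z)
    {i k j : ℤ} (hi : Bichromatic c i X) (hk : Bichromatic c k Y) (hj : Bichromatic c j Z) :
    False := by
  have per : ∀ (m : ℤ) (t : ℤ) (W : Fin 3), Bichromatic c m W → Bichromatic c (m + t * n) W := by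
    intro m t W hm
    unfold Bichromatic at *
    have e1 := (hp.int_mul t) m
    have e2 := (hp.int_mul t) (m + 1)
    rw [show m + t * n + 1 = m + 1 + t * n by ring]
    simp only [Int.cast_id] at e1 e2
    rwa [e1, e2]
  have hn' : (1 : ℤ) ≤ n := by omega
  have up : ∀ a b : ℤ, a < b + (|a| + |b| + 1) * n := by
    intro a b
    have : (|a| + |b| + 1) ≤ (|a| + |b| + 1) * n := le_mul_of_one_le_right (by positivity) hn'
    have := le_abs_self a
    have := neg_abs_le b
    omega
  have hk' := per k (|i| + |k| + 1) Y hk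
  set k' := k + (|i| + |k| + 1) * (n : ℤ) with hk'_def
  have hj' := per j (|k'| + |j| + 1) Z hj
  exact h.not_three_types_of_le _ i k' _ (up i k) (up k' j) (Int.self_le_toNat _)
    Y X Z hXY.symm hYZ hXZ hi hk' hj'

theorem RainbowFree.neg {α : Type*} {c : ℤ → α} (h : RainbowFree c) (a : ℤ) :
    RainbowFree (fun i => c (a - i)) := by
  intro x y z e
  exact h _ _ _ (by omega)

/-- The position of the first color-`G` integer after the center determines all colors near the
center, which is incompatible with `-1` and `0` both having color `B`. -/
theorem RainbowFree.double_block_center {c : ℤ → Fin 3} (h : RainbowFree c) {R B G : Fin 3}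
    (hRB : R ≠ B) (hRG : R ≠ G) (hBG : B ≠ G) (hadj : ∀ i, c i = B → c (i + 1) ≠ G)
    {k : ℤ} (hk : 1 ≤ k)
    (hm1 : c (-1) = B) (h0 : c 0 = B) (he : c (2 * k) = G) (he1 : c (2 * k + 1) = G)
    (hG : ∀ n, 0 ≤ n → n ≤ 2 * k → c n = G → k ≤ n)
    (hB : ∀ n, 0 ≤ n → n ≤ 2 * k → c n = B → n ≤ k) (hc : c k = B) : False := by
  have cover : ∀ a, a = R ∨ a = B ∨ a = G := fun a => fin_three_cover R B G a hRB hRG hBG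
  have rb : ∀ x z y, x + z = y + y → c x = B → c z = G → c y ≠ R := by
    intro x z y e h1 h2 h3
    have := h x y z e
    grind
  have rbG : ∀ x y z, x + z = y + y → c x = B → c y = G → c z ≠ R := by
    intro x y z e h1 h2 h3
    have := h x y z e
    grind
  have rGB : ∀ x y z, x + z = y + y → c y = B → c z = G → c x ≠ R := by
    intro x y z e h1 h2 h3
    have := h x y z e
    grind
  have hex : ∃ l : ℕ, 0 < l ∧ c (k + l) = G :=
    ⟨k.toNat, by omega, by rwa [show k + (k.toNat : ℤ) = 2 * k by omega]⟩
  classical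
  obtain ⟨l, ⟨hl0, hlG⟩, hmin⟩ : ∃ l : ℕ, (0 < l ∧ c (k + l) = G) ∧
      ∀ t : ℕ, 0 < t → t < l → c (k + t) ≠ G :=
    ⟨Nat.find hex, Nat.find_spec hex, fun t h1 h2 h3 => Nat.find_min hex h2 ⟨h1, h3⟩⟩
  -- The midpoint of k and whichever of 2k, 2k + 1 has the parity of k is not R, and it lies beyond
  -- the last B, so it is G.
  have hl2 : 2 * (l : ℤ) ≤ k + 1 := by
    by_contra hcon
    set m := (k + 1) / 2 with hm_def
    have e : c (k + m) = G := by
      have h1 : c (k + m) ≠ R := by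
        rcases Int.even_or_odd' k with ⟨t, ht | ht⟩
        · exact rb k (2 * k) (k + m) (by omega) hc he
        · exact rb k (2 * k + 1) (k + m) (by omega) hc he1
      have h2 : c (k + m) ≠ B := fun h2 => by
        have := hB (k + m) (by omega) (by omega) h2
        omega
      have := cover (c (k + m))
      grind
    refine hmin m.toNat (by omega) (by omega) ?_
    rwa [show (m.toNat : ℤ) = m by omega]
  have hR : ∀ t : ℤ, 0 < t → t < l → c (k + t) = R := by
    intro t h1 h2
    have h3 := hmin t.toNat (by omega) (by omega)
    rw [show (t.toNat : ℤ) = t by omega] at h3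
    have h4 : c (k + t) ≠ B := fun h4 => by
      have := hB (k + t) (by omega) (by omega) h4
      omega
    have := cover (c (k + t))
    grind
  have hl1 : (2 : ℤ) ≤ l := by
    by_contra hcon
    obtain rfl : l = 1 := by omega
    exact hadj k hc (by simpa using hlG)
  have hlodd : ∃ t : ℤ, (l : ℤ) = 2 * t + 1 := by
    rcases Int.even_or_odd' (l : ℤ) with ⟨t, ht | ht⟩
    · exact absurd (hR t (by omega) (by omega)) (rb k (k + l) (k + t) (by omega) hc hlG)
    · exact ⟨t, ht⟩
  obtain ⟨s, hs⟩ := hlodd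
  -- Reflection in k turns a G on the right into a B on the left; reflecting the B at k - jl in the
  -- G at k + l yields a G at k + (j + 2)l.
  have mult : ∀ j : ℕ, (j * l : ℤ) ≤ k + 1 → c (k - j * l) = B ∧ (0 < j → c (k + j * l) = G) := by
    have left : ∀ a : ℤ, 0 < a → a ≤ k + 1 → c (k + a) = G → c (k - a) = B := by
      intro a h1 h2 h3
      rcases eq_or_lt_of_le h2 with rfl | h2
      · rwa [show k - (k + 1) = -1 by ring]
      have h4 := rGB (k - a) k (k + a) (by ring) hc h3
      have h5 : c (k - a) ≠ G := fun h5 => by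
        have := hG (k - a) (by omega) (by omega) h5
        omega
      have := cover (c (k - a))
      grind
    intro j
    induction j using Nat.strong_induction_on with
    | _ j ih =>
      intro hj
      rcases j with _ | _ | j
      · simpa using hc
      · have := left l (by omega) (by omega) hlG
        simpa using ⟨this, hlG⟩
      · have e : (((j + 1 + 1 : ℕ) : ℤ) * l : ℤ) = j * l + 2 * l := by push_cast; ring
        rw [e] at hj ⊢
        have i1 := (ih j (by omega) (by omega)).1
        have hpos : (0 : ℤ) ≤ j * l := by positivity
        have hr : c (k + (j * l + 2 * l)) = G := by
          have h1 := rbG (k - j * l) (k + l) (k + (j * l + 2 * l)) (by ring) i1 hlG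
          rcases eq_or_lt_of_le hj with h2 | h2
          · rwa [h2, show k + (k + 1) = 2 * k + 1 by ring]
          have h3 : c (k + (j * l + 2 * l)) ≠ B := fun h3 => by
            have := hB _ (by omega) (by omega) h3
            omega
          have := cover (c (k + (j * l + 2 * l)))
          grind
        exact ⟨left _ (by omega) hj hr, fun _ => hr⟩
  have hGm : ∀ j : ℤ, 0 < j → j * l ≤ k + 1 → c (k + j * l) = G := by
    intro j h1 h2
    have := (mult j.toNat (by rwa [Int.toNat_of_nonneg h1.le])).2 (by omega)
    rwa [Int.toNat_of_nonneg h1.le] at this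
  have hRm : ∀ t : ℤ, 0 < t → t < l → c (k - t) = R := by
    intro t h1 h2
    have h3 : c (k - t) ≠ G := fun h3 => by
      have := hG _ (by omega) (by omega) h3
      omega
    have h4 : c (k - t) ≠ B := by
      intro h4
      rcases Int.even_or_odd' t with ⟨u, hu | hu⟩
      · exact rb (k - t) (k + 2 * l) (k + (l - u)) (by omega) h4 (hGm 2 (by omega) hl2)
          (hR _ (by omega) (by omega))
      · exact rb (k - t) (k + l) (k + (s - u)) (by omega) h4 hlG (hR _ (by omega) (by omega))
    have := cover (c (k - t))
    grind
  -- In each case B at 0 or -1 and G at a suitable k + jl have their midpoint strictly between k - l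
  -- and k, where everything is R. Oddness of l supplies the right parity.
  obtain ⟨q, r, hqr, hr0, hrl⟩ : ∃ q r : ℤ, k + 1 = q * l + r ∧ 0 ≤ r ∧ r < l :=
    ⟨(k + 1) / l, (k + 1) % l, by rw [mul_comm]; exact (Int.mul_ediv_add_emod _ _).symm,
      Int.emod_nonneg _ (by omega), Int.emod_lt_of_pos _ (by omega)⟩
  have hq2 : 2 ≤ q := by
    by_contra hcon
    have : q * l ≤ 1 * l := by gcongr; omega
    omega
  have hG1 := hGm (q - 1) (by omega) (by linarith)
  have eq1 : (q - 1) * l = q * l - l := by ring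
  rw [eq1] at hG1
  rcases eq_or_lt_of_le hr0 with rfl | hr0
  · exact rb 0 (k + (q * l - l)) (k - s) (by omega) h0 hG1 (hRm _ (by omega) (by omega))
  rcases Int.even_or_odd' r with ⟨u, hu | hu⟩
  · exact rb (-1) (k + q * l) (k - u) (by omega) hm1 (hGm q (by omega) (by omega))
      (hRm _ (by omega) (by omega))
  · exact rb (-1) (k + (q * l - l)) (k - (s + u + 1)) (by omega) hm1 hG1
      (hRm _ (by omega) (by omega))

/-- If `B` and `G` never occur at consecutive integers, then `B, B` and a later `G, G` cannot both
occur at consecutive integers. -/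
theorem RainbowFree.not_double_blocks_of_le {c : ℤ → Fin 3} (h : RainbowFree c) (n : ℕ) :
    ∀ R B G : Fin 3, R ≠ B → R ≠ G → B ≠ G → (∀ i, c i = B → c (i + 1) ≠ G) →
      (∀ i, c i = G → c (i + 1) ≠ B) → ∀ i j : ℤ, i < j → j - i ≤ n →
      c i = B → c (i + 1) = B → c j = G → c (j + 1) = G → False := by
  induction n with
  | zero => intros; omega
  | succ n ih =>
    intro R B G hRB hRG hBG hadj hadj' i j hij hn hi hi1 hj hj1
    have cover : ∀ a, a = R ∨ a = B ∨ a = G := fun a => fin_three_cover R B G a hRB hRG hBG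
    have inner : ∀ m, i < m → m < j → c m = R ∨ c (m + 1) = R := by
      intro m h1 h2
      by_contra! hcon
      have a1 := hadj m
      have a2 := hadj' m
      have := cover (c m)
      have := cover (c (m + 1))
      rcases cover (c m) with h3 | h3 | h3
      · exact hcon.1 h3
      · exact ih R B G hRB hRG hBG hadj hadj' m j h2 (by push_cast at hn; omega) h3
          (by grind) hj hj1
      · exact ih R B G hRB hRG hBG hadj hadj' i m h1 (by push_cast at hn; omega) hi hi1 h3
          (by grind)
    have rb : ∀ x z y, x + z = y + y → c x = B → c z = G → c y ≠ R := by
      intro x y z e h1 h2 h3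
      have := h x z y e
      grind
    have hne : j ≠ i + 1 := by rintro rfl; exact hBG (hi1.symm.trans hj)
    obtain ⟨k, hk | hk⟩ := Int.even_or_odd' (j - (i + 1))
    swap
    · have h1 := rb i j (i + 1 + k) (by omega) hi hj
      have h2 := rb (i + 1) (j + 1) (i + 1 + k + 1) (by omega) hi1 hj1
      rcases eq_or_ne k 0 with rfl | hk0
      · exact hadj (i + 1) hi1 (by rwa [show i + 1 + 1 = j by omega])
      · have := inner (i + 1 + k) (by omega) (by omega)
        grind
    -- A G in the left half reflects the block i, i + 1 to two consecutive points that are not R,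
    -- contradicting `inner`; `hB` is the mirror image.
    have hG : ∀ m, 0 ≤ m → m ≤ 2 * k → c (i + 1 + m) = G → k ≤ m := by
      intro m h1 h2 h3
      by_contra hcon
      have a1 := h (i + 1) (i + 1 + m) (i + 1 + 2 * m) (by omega)
      have a2 := h i (i + 1 + m) (i + 1 + 2 * m + 1) (by omega)
      have := inner (i + 1 + 2 * m) (by omega) (by omega)
      grind
    have hB : ∀ m, 0 ≤ m → m ≤ 2 * k → c (i + 1 + m) = B → m ≤ k := by
      intro m h1 h2 h3
      by_contra hcon
      have a1 := h (i + 2 * m - 2 * k) (i + 1 + m) (j + 1) (by omega)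
      have a2 := h (i + 2 * m - 2 * k + 1) (i + 1 + m) j (by omega)
      have := inner (i + 2 * m - 2 * k) (by omega) (by omega)
      grind
    have hmid : c (i + 1 + k) ≠ R := rb (i + 1) j (i + 1 + k) (by omega) hi1 hj
    rcases cover (c (i + 1 + k)) with hc | hc | hc
    · exact hmid hc
    · refine (h.shift (i + 1)).double_block_center hRB hRG hBG ?_ (k := k) (by omega) ?_ ?_ ?_ ?_
        hG hB hc
      · intro m hm
        rw [← add_assoc]
        exact hadj _ hm
      · rwa [show i + 1 + -1 = i by ring]
      · rwa [add_zero]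
      · rwa [show i + 1 + 2 * k = j by omega]
      · rwa [show i + 1 + (2 * k + 1) = j + 1 by omega]
    · refine (h.neg j).double_block_center hRG hRB hBG.symm ?_ (k := k) (by omega) ?_ ?_ ?_ ?_
        ?_ ?_ ?_
      · intro m hm hm2
        exact hadj _ hm2 (by rwa [show j - (m + 1) + 1 = j - m by ring])
      · rwa [show j - -1 = j + 1 by ring]
      · rwa [sub_zero]
      · rwa [show j - 2 * k = i + 1 by omega]
      · rwa [show j - (2 * k + 1) = i by omega]
      · intro m h1 h2 h3
        have := hB (2 * k - m) (by omega) (by omega)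
          (by rwa [show i + 1 + (2 * k - m) = j - m by omega])
        omega
      · intro m h1 h2 h3
        have := hG (2 * k - m) (by omega) (by omega)
          (by rwa [show i + 1 + (2 * k - m) = j - m by omega])
        omega
      · rwa [show j - k = i + 1 + k by omega]

theorem RainbowFree.not_double_blocks {c : ℤ → Fin 3} (h : RainbowFree c) {n : ℕ} (hn : n ≠ 0)
    (hp : Function.Periodic c (n : ℤ)) {R B G : Fin 3} (hRB : R ≠ B) (hRG : R ≠ G) (hBG : B ≠ G)
    (hadj : ∀ i, c i = B → c (i + 1) ≠ G) (hadj' : ∀ i, c i = G → c (i + 1) ≠ B) {i j : ℤ}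
    (hi : c i = B) (hi1 : c (i + 1) = B) (hj : c j = G) (hj1 : c (j + 1) = G) : False := by
  have hn' : (1 : ℤ) ≤ n := by omega
  have up : i < j + (|i| + |j| + 1) * n := by
    have : (|i| + |j| + 1) ≤ (|i| + |j| + 1) * n := le_mul_of_one_le_right (by positivity) hn'
    have := le_abs_self i
    have := neg_abs_le j
    omega
  have e1 := (hp.int_mul (|i| + |j| + 1)) j
  have e2 := (hp.int_mul (|i| + |j| + 1)) (j + 1)
  simp only [Int.cast_id] at e1 e2
  refine h.not_double_blocks_of_le _ R B G hRB hRG hBG hadj hadj' i _ up (Int.self_le_toNat _)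
    hi hi1 (e1.trans hj) ?_
  rw [add_right_comm]
  exact e2.trans hj1

/-! ### Prime moduli: a color used once, and at most three colors -/

theorem exists_eq_add_zsmul {p : ℕ} [Fact p.Prime] {d : ZMod p} (hd : d ≠ 0) (a x : ZMod p) :
    ∃ i : ℤ, x = a + i • d := by
  refine ⟨(((x - a) / d).val : ℤ), ?_⟩
  rw [zsmul_eq_mul, Int.cast_natCast, ZMod.natCast_zmod_val, div_mul_cancel₀ _ hd]
  ring

theorem periodic_progression {α : Type*} {n : ℕ} (c : ZMod n → α) (a d : ZMod n) :
    Function.Periodic (fun i : ℤ => c (a + i • d)) (n : ℤ) := by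
  intro i
  simp

/-- For each nonzero difference some pair of distinct colors does not occur. -/
theorem RainbowFree.exists_dominant {p : ℕ} [Fact p.Prime] {c : ZMod p → Fin 3}
    (h : RainbowFree c) {d : ZMod p} (hd : d ≠ 0) :
    ∃ X, ∀ x, c x ≠ X → c (x + d) ≠ X → c x = c (x + d) := by
  by_contra! hcon
  have key : ∀ X, ∃ i, Bichromatic (fun i : ℤ => c (0 + i • d)) i X := by
    intro X
    obtain ⟨x, h1, h2, h3⟩ := hcon X
    obtain ⟨i, hi⟩ := exists_eq_add_zsmul hd 0 x
    refine ⟨i, ?_⟩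
    unfold Bichromatic
    have e : (0 : ZMod p) + (i + 1) • d = x + d := by rw [hi, add_zsmul, one_zsmul]; abel
    simp only [e, ← hi]
    exact ⟨h3, h1, h2⟩
  obtain ⟨i, hi⟩ := key 0
  obtain ⟨j, hj⟩ := key 1
  obtain ⟨k, hk⟩ := key 2
  exact (h.progression 0 d).not_three_types (NeZero.ne p) (periodic_progression c 0 d)
    (by decide) (by decide) (by decide) hi hj hk

/-- Since B and G are never at distance d, failure of both alternatives yields a block B, B and a
block G, G along the progression of difference d, against `not_double_blocks`. -/
theorem RainbowFree.isolated_of_dominant {p : ℕ} [Fact p.Prime] {c : ZMod p → Fin 3}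
    (h : RainbowFree c) {d : ZMod p} (hd : d ≠ 0) {R B G : Fin 3} (hRB : R ≠ B) (hRG : R ≠ G)
    (hBG : B ≠ G) (hR : ∀ x, c x ≠ R → c (x + d) ≠ R → c x = c (x + d)) :
    (∀ x, c x = B → c (x + d) = R) ∨ (∀ x, c x = G → c (x + d) = R) := by
  by_contra! hcon
  obtain ⟨⟨x, hx, hx'⟩, ⟨y, hy, hy'⟩⟩ := hcon
  obtain ⟨i, rfl⟩ := exists_eq_add_zsmul hd 0 x
  obtain ⟨j, rfl⟩ := exists_eq_add_zsmul hd 0 y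
  have e : ∀ i : ℤ, (0 : ZMod p) + (i + 1) • d = 0 + i • d + d := by
    intro i
    rw [add_zsmul, one_zsmul]; abel
  refine (h.progression 0 d).not_double_blocks (NeZero.ne p) (periodic_progression c 0 d)
    hRB hRG hBG ?_ ?_ (i := i) (j := j) hx ?_ hy ?_
  · intro i h1 h2
    rw [e] at h2
    have := hR (0 + i • d)
    grind
  · intro i h1 h2
    rw [e] at h2
    have := hR (0 + i • d)
    grind
  · have := hR (0 + i • d)
    change c _ = B
    rw [e]
    grind
  · have := hR (0 + j • d)
    change c _ = G
    rw [e]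
    grind

theorem eq_of_invariant {p : ℕ} [Fact p.Prime] {α : Type*} {c : ZMod p → α} {d : ZMod p}
    (hd : d ≠ 0) {R : α} (hR : ∀ x, c x = R → c (x + d) = R) {a : ZMod p} (ha : c a = R)
    (x : ZMod p) : c x = R := by
  have key : ∀ n : ℕ, c (a + n • d) = R := by
    intro n
    induction n with
    | zero => simpa using ha
    | succ n ih =>
      rw [succ_nsmul, ← add_assoc]
      exact hR _ ih
  have := key ((x - a) / d).val
  rwa [nsmul_eq_mul, ZMod.natCast_zmod_val, div_mul_cancel₀ _ hd, add_sub_cancel] at this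

theorem two_ne_zero_of_ne_two {p : ℕ} [Fact p.Prime] (hp : p ≠ 2) : (2 : ZMod p) ≠ 0 := by
  intro h
  have : ((2 : ℕ) : ZMod p) = 0 := by exact_mod_cast h
  rw [ZMod.natCast_eq_zero_iff, Nat.prime_dvd_prime_iff_eq Fact.out Nat.prime_two] at this
  exact hp this

/-- A smallest color class cannot be adjacent to each occurrence of another color. -/
theorem not_forall_neighbors {p : ℕ} [Fact p.Prime] (hp : p ≠ 2) {c : ZMod p → Fin 3}
    {d : ZMod p} (hd : d ≠ 0) {B R : Fin 3} (hBR : B ≠ R) (hB : ∃ x, c x = B) (hR : ∃ x, c x = R)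
    (hcard : (Finset.univ.filter (c · = B)).card ≤ (Finset.univ.filter (c · = R)).card)
    (h1 : ∀ x, c x = R → c (x + d) = B) (h2 : ∀ x, c x = R → c (x - d) = B) : False := by
  have surj : ∀ y, c y = B → c (y + d) = R := by
    intro y hy
    have himg : (Finset.univ.filter (c · = R)).image (· - d) = Finset.univ.filter (c · = B) := by
      apply Finset.eq_of_subset_of_card_le
      · intro z hz
        simp only [Finset.mem_image, Finset.mem_filter, Finset.mem_univ, true_and] at hz ⊢
        obtain ⟨x, hx, rfl⟩ := hz
        exact h2 x hx
      · rwa [Finset.card_image_of_injective _ (sub_left_injective)]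
    have : y ∈ (Finset.univ.filter (c · = R)).image (· - d) := by
      rw [himg]; simpa using hy
    simp only [Finset.mem_image, Finset.mem_filter, Finset.mem_univ, true_and] at this
    obtain ⟨x, hx, rfl⟩ := this
    simpa using hx
  obtain ⟨b, hb⟩ := hB
  obtain ⟨r, hr⟩ := hR
  have h2d : d + d ≠ 0 := by
    rw [← two_mul]
    exact mul_ne_zero (two_ne_zero_of_ne_two hp) hd
  have := eq_of_invariant h2d (c := c) (R := R)
    (fun x hx => by rw [← add_assoc]; exact surj _ (h1 x hx)) hr b
  exact hBR (hb.symm.trans this)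

theorem fin_three_others : ∀ B : Fin 3, ∃ R G : Fin 3, B ≠ R ∧ B ≠ G ∧ R ≠ G := by decide

open Finset Pointwise in
/-- In a rainbow-free coloring of `ZMod p` with exactly three colors, some color is used once. -/
theorem RainbowFree.exists_singleton {p : ℕ} [Fact p.Prime] {c : ZMod p → Fin 3}
    (h : RainbowFree c) (hs : Function.Surjective c) : ∃ a, ∀ x, c x = c a → x = a := by
  have hp : p ≠ 2 := by
    rintro rfl
    have := Fintype.card_le_of_surjective c hs
    rw [ZMod.card, Fintype.card_fin] at this
    omega
  obtain ⟨B, -, hBmin⟩ := exists_min_image univ (fun X => (univ.filter (c · = X)).card)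
    ⟨0, mem_univ _⟩
  obtain ⟨R, G, hBR, hBG, hRG⟩ := fin_three_others B
  have cover : ∀ a, a = B ∨ a = R ∨ a = G := fun a => fin_three_cover B R G a hBR hBG hRG
  -- If B were dominant, some other color X would be followed only by B. Dominance then makes X also
  -- preceded only by B, and B is too small a class for that.
  have notB : ∀ d : ZMod p, d ≠ 0 → ¬ ∀ x, c x ≠ B → c (x + d) ≠ B → c x = c (x + d) := by
    have main : ∀ d : ZMod p, d ≠ 0 → ∀ X Y, B ≠ X → B ≠ Y → X ≠ Y →
        (∀ x, c x ≠ B → c (x + d) ≠ B → c x = c (x + d)) →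
        ¬ ∀ x, c x = X → c (x + d) = B := by
      intro d hd X Y hBX hBY hXY hdom hX
      refine not_forall_neighbors hp hd hBX (hs B) (hs X) (hBmin X (mem_univ _)) hX ?_
      intro x hx
      have a1 := hX (x - d)
      have a2 := hdom (x - d)
      have a3 := fin_three_cover B X Y (c (x - d)) hBX hBY hXY
      rw [sub_add_cancel] at a1 a2
      grind
    intro d hd hdom
    rcases h.isolated_of_dominant hd hBR hBG hRG hdom with h1 | h1
    · exact main d hd R G hBR hBG hRG hdom h1
    · exact main d hd G R hBG hBR hRG.symm hdom h1
  set SB := univ.filter (c · = B) with hSB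
  set SR := univ.filter (c · = R) with hSR
  set SG := univ.filter (c · = G) with hSG
  have nB : SB.Nonempty := by obtain ⟨x, hx⟩ := hs B; exact ⟨x, by simpa [hSB] using hx⟩
  have nR : SR.Nonempty := by obtain ⟨x, hx⟩ := hs R; exact ⟨x, by simpa [hSR] using hx⟩
  have nG : SG.Nonempty := by obtain ⟨x, hx⟩ := hs G; exact ⟨x, by simpa [hSG] using hx⟩
  have htot : SB.card + SR.card + SG.card = p := by
    have hd1 : Disjoint SB SR := by
      rw [disjoint_left]; intro x; simp only [hSB, hSR, mem_filter]; grind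
    have hd2 : Disjoint (SB ∪ SR) SG := by
      rw [disjoint_left]; intro x; simp only [hSB, hSR, hSG, mem_union, mem_filter]; grind
    rw [← card_union_of_disjoint hd1, ← card_union_of_disjoint hd2]
    have : SB ∪ SR ∪ SG = univ := by
      ext x
      have := cover (c x)
      simp only [hSB, hSR, hSG, mem_union, mem_filter, mem_univ, true_and, iff_true]
      grind
    rw [this, card_univ, ZMod.card]
  have c1 := ZMod.cauchy_davenport (Fact.out : p.Prime) nB nG.neg
  have c2 := ZMod.cauchy_davenport (Fact.out : p.Prime) nB nR.neg
  rw [card_neg] at c1 c2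
  -- A common difference d would place B next to G and B next to R, leaving B as the only possible
  -- dominant color.
  have hdisj : Disjoint (SB + -SG) (SB + -SR) := by
    rw [disjoint_left]
    intro d h1 h2
    simp only [mem_add, mem_neg, hSB, hSR, hSG, mem_filter, mem_univ, true_and] at h1 h2
    obtain ⟨b, hb, _, ⟨g, hg, rfl⟩, rfl⟩ := h1
    obtain ⟨b', hb', _, ⟨r, hr, rfl⟩, he⟩ := h2
    have hd : b + -g ≠ 0 := by
      intro h0
      rw [add_neg_eq_zero] at h0
      exact hBG (by rw [← hb, ← hg, h0])
    obtain ⟨X, hX⟩ := h.exists_dominant hd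
    have a1 := hX g
    rw [show g + (b + -g) = b by ring] at a1
    have a2 := hX r
    rw [← he, show r + (b' + -r) = b' by ring] at a2
    rcases cover X with rfl | rfl | rfl
    · exact notB _ hd hX
    · grind
    · grind
  have h0 : (0 : ZMod p) ∉ (SB + -SG) ∪ (SB + -SR) := by
    simp only [mem_union, mem_add, mem_neg, hSB, hSR, hSG, mem_filter, mem_univ, true_and]
    rintro (⟨b, hb, _, ⟨g, hg, rfl⟩, he⟩ | ⟨b, hb, _, ⟨g, hg, rfl⟩, he⟩)
    · rw [add_neg_eq_zero] at he
      exact hBG (by rw [← hb, ← hg, he])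
    · rw [add_neg_eq_zero] at he
      exact hBR (by rw [← hb, ← hg, he])
  have hle : ((SB + -SG) ∪ (SB + -SR)).card < p := by
    have := card_lt_univ_of_notMem h0
    rwa [ZMod.card] at this
  -- Now (|B| + |G| - 1) + (|B| + |R| - 1) = p + |B| - 2 must be less than p.
  rw [card_union_of_disjoint hdisj] at hle
  have hB1 := nB.card_pos
  have hR1 := nR.card_pos
  have hG1 := nG.card_pos
  have : SB.card = 1 := by omega
  obtain ⟨a, ha⟩ := card_eq_one.mp this
  have hca : c a = B := by
    have : a ∈ SB := by rw [ha]; simp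
    simpa [hSB] using this
  refine ⟨a, fun x hx => ?_⟩
  have : x ∈ SB := by simp [hSB, hx, hca]
  rw [ha] at this
  simpa using this

/-- Merging two colors leaves three, and the merged one is used at least twice, so one of the other
two is used once. Doing this for complementary pairs gives two such points s ≠ t; then 2t - s must
share a color with s or t, hence equal one of them, which is impossible. -/
theorem RainbowFree.not_surjective_fin_four {p : ℕ} [Fact p.Prime] {c : ZMod p → Fin 4}
    (h : RainbowFree c) : ¬ Function.Surjective c := by
  intro hs
  have hp : 4 ≤ p := by
    have := Fintype.card_le_of_surjective c hs
    rwa [ZMod.card, Fintype.card_fin] at this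
  let Single : Fin 4 → Prop := fun X => ∃ a, c a = X ∧ ∀ x, c x = X → x = a
  have merge : ∀ X Y Z W : Fin 4, X ≠ Y → X ≠ Z → X ≠ W → Y ≠ Z → Y ≠ W → Z ≠ W →
      Single X ∨ Single Y := by
    intro X Y Z W hXY hXZ hXW hYZ hYW hZW
    let f : Fin 4 → Fin 3 := fun a => if a = X then 0 else if a = Y then 1 else 2
    have hf : Function.Surjective f := by
      intro i
      fin_cases i
      · exact ⟨X, by simp [f]⟩
      · exact ⟨Y, by simp [f, hXY.symm]⟩
      · exact ⟨Z, by simp [f, hXZ.symm, hYZ.symm]⟩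
    obtain ⟨a, ha⟩ := (h.comp f).exists_singleton (hf.comp hs)
    simp only [Function.comp_apply] at ha
    by_cases h1 : c a = X
    · exact Or.inl ⟨a, h1, fun x hx => ha x (by rw [hx, h1])⟩
    by_cases h2 : c a = Y
    · exact Or.inr ⟨a, h2, fun x hx => ha x (by rw [hx, h2])⟩
    obtain ⟨z, hz⟩ := hs Z
    obtain ⟨w, hw⟩ := hs W
    have e1 := ha z (by simp [f, h1, h2, hz, hXZ.symm, hYZ.symm])
    have e2 := ha w (by simp [f, h1, h2, hw, hXW.symm, hYW.symm])
    exact absurd (by rw [← hz, ← hw, e1, e2]) hZW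
  have two : ∃ X Y : Fin 4, X ≠ Y ∧ Single X ∧ Single Y := by
    have m01 := merge 0 1 2 3 (by decide) (by decide) (by decide) (by decide) (by decide) (by decide)
    have m23 := merge 2 3 0 1 (by decide) (by decide) (by decide) (by decide) (by decide) (by decide)
    rcases m01 with s | s <;> rcases m23 with t | t
    exacts [⟨_, _, by decide, s, t⟩, ⟨_, _, by decide, s, t⟩, ⟨_, _, by decide, s, t⟩,
      ⟨_, _, by decide, s, t⟩]
  obtain ⟨X, Y, hXY, ⟨s, hs1, hs2⟩, ⟨t, ht1, ht2⟩⟩ := two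
  have hst : s ≠ t := by rintro rfl; exact hXY (hs1.symm.trans ht1)
  have h2 : t - s = 0 := by
    have h1 := h s t (2 * t - s) (by ring)
    by_cases h2 : c (2 * t - s) = X
    · have h3 : (2 : ZMod p) * (t - s) = 0 := by linear_combination hs2 _ h2
      exact (mul_eq_zero.mp h3).resolve_left (two_ne_zero_of_ne_two (by omega))
    · have h3 : c (2 * t - s) = Y := by grind
      linear_combination ht2 _ h3
  exact hst (sub_eq_zero.mp h2).symm

/-! ### Counting colors of periodic colorings of the integers -/

open Set

theorem Periodic.finite_range {α : Type*} {c : ℤ → α} {n : ℕ} (hn : n ≠ 0)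
    (hp : Function.Periodic c (n : ℤ)) : (range c).Finite := by
  refine ((finite_Ico (0 : ℤ) n).image c).subset ?_
  rintro _ ⟨x, rfl⟩
  obtain ⟨y, hy, e⟩ := hp.exists_mem_Ico₀ (by omega) x
  exact ⟨y, hy, e.symm⟩

theorem exists_surjective_comp {c : ℤ → ℕ} {k : ℕ} (hk : k ≠ 0) (h : k ≤ (range c).ncard) :
    ∃ f : ℕ → Fin k, Function.Surjective (f ∘ c) := by
  have : NeZero k := ⟨hk⟩
  obtain ⟨s, hs, hcard⟩ := exists_subset_card_eq h
  have hfin : s.Finite := finite_of_ncard_ne_zero (by omega)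
  have : Fintype s := hfin.fintype
  have e : Fin k ≃ s := (Fintype.equivFinOfCardEq (by
    rw [← Nat.card_eq_fintype_card, Nat.card_coe_set_eq, hcard])).symm
  refine ⟨Function.invFun (fun i => (e i : ℕ)), fun i => ?_⟩
  obtain ⟨x, hx⟩ := hs (e i).2
  refine ⟨x, ?_⟩
  rw [Function.comp_apply, hx]
  exact Function.leftInverse_invFun (f := fun i => (e i : ℕ))
    (Subtype.val_injective.comp e.injective) i

theorem le_ncard_range_of_surjective {c : ℤ → ℕ} {k : ℕ} (hfin : (range c).Finite)
    {f : ℕ → Fin k} (hf : Function.Surjective (f ∘ c)) : k ≤ (range c).ncard := by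
  have h1 : f '' range c = univ := by rw [← range_comp]; exact hf.range_eq
  have := ncard_image_le (f := f) hfin
  rwa [h1, ncard_univ, Nat.card_eq_fintype_card, Fintype.card_fin] at this

/-- Descending a periodic coloring of `ℤ` to `ZMod n`. -/
theorem Periodic.exists_zmod {α : Type*} {c : ℤ → α} {n : ℕ}
    (hp : Function.Periodic c (n : ℤ)) (h : RainbowFree c) :
    ∃ c' : ZMod n → α, RainbowFree c' ∧ ∀ i : ℤ, c' i = c i := by
  have key : ∀ i : ℤ, c ((i : ZMod n).cast : ℤ) = c i := by
    intro i
    rw [ZMod.coe_intCast, Int.emod_def, mul_comm]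
    simpa using hp.sub_int_mul_eq (i / n) (x := i)
  refine ⟨fun x => c (x.cast : ℤ), ?_, key⟩
  intro x y z e
  obtain ⟨i, rfl⟩ := ZMod.intCast_surjective x
  obtain ⟨j, rfl⟩ := ZMod.intCast_surjective y
  have hz : z = ((j + j - i : ℤ) : ZMod n) := by
    push_cast
    rw [← e]; ring
  subst hz
  simp only [key]
  exact h _ _ _ (by ring)

theorem RainbowFree.comp_intCast {α : Type*} {n : ℕ} {c : ZMod n → α} (h : RainbowFree c) :
    RainbowFree (fun i : ℤ => c i) := by
  simpa using h.comp_affine 0 (Int.castAddHom (ZMod n))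

theorem periodic_comp_intCast {α : Type*} {n : ℕ} (c : ZMod n → α) :
    Function.Periodic (fun i : ℤ => c i) (n : ℤ) := by
  intro i
  simp

/-- `k` is the maximal number of colors in a rainbow-free coloring of `ℤ` with period `n`. -/
def IsMaxColors (n k : ℕ) : Prop :=
  (∃ c : ℤ → ℕ, Function.Periodic c (n : ℤ) ∧ RainbowFree c ∧ k ≤ (range c).ncard) ∧
    ∀ c : ℤ → ℕ, Function.Periodic c (n : ℤ) → RainbowFree c → (range c).ncard ≤ k

/-- Distinct colors force distinct terms, so injectivity in `IsAP` costs nothing, and degenerate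
solutions of x + z = 2y are never rainbow. -/
theorem hasRainbowAP_iff {n r : ℕ} (c : ↥(univ : Set (ZMod n)) → Fin r) :
    HasRainbowAP c 3 ↔ ¬ RainbowFree (fun x : ZMod n => c ⟨x, mem_univ x⟩) := by
  constructor
  · rintro ⟨x, ⟨-, a, d, hx⟩, hc⟩ hf
    have h0 := hx 0
    have h1 := hx 1
    have h2 := hx 2
    simp only [Fin.val_zero, Fin.val_one, Fin.val_two, zero_nsmul, one_nsmul, two_nsmul,
      add_zero] at h0 h1 h2
    have := hf (x 0 : ZMod n) (x 1 : ZMod n) (x 2 : ZMod n) (by rw [h0, h1, h2]; abel)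
    rcases this with h | h | h
    · exact absurd (hc h) (by decide)
    · exact absurd (hc h) (by decide)
    · exact absurd (hc h) (by decide)
  · intro hf
    simp only [RainbowFree, not_forall, not_or] at hf
    obtain ⟨x, y, z, e, h1, h2, h3⟩ := hf
    have hinj : Function.Injective (fun i : Fin 3 => c (![⟨x, mem_univ x⟩, ⟨y, mem_univ y⟩,
        ⟨z, mem_univ z⟩] i)) := by
      intro i j hij
      fin_cases i <;> fin_cases j <;> simp_all [eq_comm]
    refine ⟨![⟨x, mem_univ x⟩, ⟨y, mem_univ y⟩, ⟨z, mem_univ z⟩], ⟨?_, x, y - x, ?_⟩, hinj⟩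
    · intro i j hij
      exact hinj (congrArg c (Subtype.ext hij))
    · intro i
      fin_cases i
      · simp
      · simp
      · have : z = x + 2 • (y - x) := by
          rw [eq_sub_of_add_eq' e]; abel
        simpa using this

theorem awZ_eq_of_isMaxColors {n k : ℕ} (hn : n ≠ 0) (h : IsMaxColors n k) :
    awZ n 3 = k + 1 := by
  obtain ⟨⟨c, hp, hc, hcard⟩, hmax⟩ := h
  refine IsLeast.csInf_eq ⟨⟨by omega, fun c' hs => ?_⟩, ?_⟩
  · rw [hasRainbowAP_iff]
    intro hf
    set g : ℤ → ℕ := fun i : ℤ => (c' ⟨(i : ZMod n), mem_univ _⟩ : ℕ) with hg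
    have hgp : Function.Periodic g (n : ℤ) := 
      (periodic_comp_intCast (fun x : ZMod n => c' ⟨x, mem_univ _⟩)).comp Fin.val
    have hle := hmax g hgp (hf.comp_intCast.comp Fin.val)
    have hge : k + 1 ≤ (range g).ncard := by
      refine le_ncard_range_of_surjective (Periodic.finite_range hn hgp) (f := Fin.ofNat (k + 1)) ?_
      intro i
      obtain ⟨⟨x, hx⟩, rfl⟩ := hs i
      obtain ⟨j, rfl⟩ := ZMod.intCast_surjective x
      exact ⟨j, by simp [g]⟩
    omega
  · rintro r ⟨hr1, hr⟩
    by_contra! hlt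
    obtain ⟨f, hf⟩ := exists_surjective_comp (k := r) (by omega) (show r ≤ (range c).ncard by omega)
    obtain ⟨c', hc', e⟩ := Periodic.exists_zmod (hp.comp f) (hc.comp f)
    have := hr (fun x => c' x.1) (fun i => by
      obtain ⟨x, hx⟩ := hf i
      exact ⟨⟨(x : ZMod n), mem_univ _⟩, (e x).trans hx⟩)
    rw [hasRainbowAP_iff] at this
    exact this hc'

theorem rainbowFree_of_two_colors {G : Type*} [AddCommGroup G] (p : G → Prop) [DecidablePred p]
    (a b : ℕ) : RainbowFree (fun x => if p x then a else b) := by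
  intro x y z _
  grind

theorem range_ite_dvd {n : ℕ} (hn : 2 ≤ n) :
    range (fun x : ℤ => if (n : ℤ) ∣ x then 0 else 1) = ({0, 1} : Set ℕ) := by
  ext y
  constructor
  · rintro ⟨x, rfl⟩
    by_cases h : (n : ℤ) ∣ x <;> simp [h]
  · rintro (rfl | rfl)
    · exact ⟨0, by simp⟩
    · refine ⟨1, ?_⟩
      have : ¬ (n : ℤ) ∣ 1 := fun h => by
        have := Int.le_of_dvd one_pos h
        omega
      simp [this]

theorem periodic_ite_dvd (n : ℕ) (a b : ℕ) :
    Function.Periodic (fun x : ℤ => if (n : ℤ) ∣ x then a else b) (n : ℤ) := by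
  intro x
  simp

theorem isMaxColors_one : IsMaxColors 1 1 := by
  have key : ∀ c : ℤ → ℕ, Function.Periodic c ((1 : ℕ) : ℤ) → range c = {c 0} := by
    intro c hp
    refine Subset.antisymm ?_ (by rintro _ rfl; exact ⟨0, rfl⟩)
    rintro _ ⟨x, rfl⟩
    have := hp.int_mul_eq x
    simpa using this
  refine ⟨⟨fun _ => 0, fun _ => rfl, fun _ _ _ _ => Or.inl rfl, ?_⟩, fun c hp _ => ?_⟩
  · rw [key _ (fun _ => rfl)]; simp
  · rw [key c hp]; simp

/-! ### Powers of two -/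

theorem exists_step {φ : ℕ → Fin 3} {t : ℕ} {B R : Fin 3} (h0 : φ 0 = B) (ht : φ t = R)
    (hBR : B ≠ R) (h : ∀ i, φ i = B ∨ φ i = R) : ∃ i, φ i = B ∧ φ (i + 1) = R := by
  by_contra! hcon
  have : ∀ i, φ i = B := by
    intro i
    induction i with
    | zero => exact h0
    | succ i ih => exact (h (i + 1)).resolve_right (hcon i ih)
  exact hBR ((this t).symm.trans ht)

/-- In a coloring with period `2 ^ (a + 1)`, integers of the same parity are reached from each
other by even multiples of any odd number. -/
theorem exists_eq_of_odd_step {α : Type*} {c : ℤ → α} {a : ℕ}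
    (hp : Function.Periodic c ((2 ^ (a + 1) : ℕ) : ℤ)) {d : ℤ} (hd : Odd d) {x y : ℤ}
    (hxy : Even (y - x)) : ∃ t : ℕ, c (x + 2 * t * d) = c y := by
  obtain ⟨e, he⟩ := hxy
  have hcop : IsCoprime d (2 ^ a : ℤ) := by
    apply IsCoprime.pow_right
    obtain ⟨k, rfl⟩ := hd
    exact ⟨1, -k, by ring⟩
  obtain ⟨u, v, huv⟩ := hcop
  have hpos : (0 : ℤ) < 2 ^ a := by positivity
  -- As u inverts d modulo 2 ^ a, 2ued agrees with 2e = y - x modulo the period.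
  refine ⟨((u * e) % 2 ^ a).toNat, ?_⟩
  rw [Int.toNat_of_nonneg (Int.emod_nonneg _ hpos.ne'), Int.emod_def]
  have := hp.sub_int_mul_eq (v * e + d * (u * e / 2 ^ a)) (x := y)
  rw [← this]
  congr 1
  have hy : y = x + 2 * e := by linarith
  rw [hy]
  push_cast
  linear_combination 2 * e * huv

/-- By induction each parity class misses a color: the evens miss B, the odds miss G. The third
color R occurs in both parities, for otherwise a rainbow triple of consecutive integers appears.
Along the odd difference g - b, from a B to a G, all three bichromatic types then occur. -/
theorem not_surjective_of_periodic_two_pow (a : ℕ) : ∀ c : ℤ → Fin 3,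
    Function.Periodic c ((2 ^ a : ℕ) : ℤ) → RainbowFree c → ¬ Function.Surjective c := by
  induction a with
  | zero =>
    intro c hp _ hs
    obtain ⟨x, hx⟩ := hs 0
    obtain ⟨y, hy⟩ := hs 1
    have h1 := hp.int_mul_eq x
    have h2 := hp.int_mul_eq y
    simp only [pow_zero, Nat.cast_one, mul_one, Int.cast_id] at h1 h2
    rw [h1, ← h2, hy] at hx
    exact absurd hx (by decide)
  | succ a ih =>
    intro c hp h hs
    have half : ∀ s : ℤ, ∃ X, ∀ x, Even (x - s) → c x ≠ X := by
      intro s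
      have h1 := ih (fun i => c (s + i • 2)) (fun i => by
        have := hp (s + i • 2)
        simp only [zsmul_eq_mul, Int.cast_id] at this ⊢
        rw [← this]
        congr 1
        push_cast
        ring) (h.progression s 2)
      by_contra! hcon
      refine h1 fun X => ?_
      obtain ⟨x, ⟨e, he⟩, hx⟩ := hcon X
      refine ⟨e, ?_⟩
      rw [← hx]
      change c (s + e • 2) = c x
      congr 1
      rw [zsmul_eq_mul, Int.cast_id]
      omega
    obtain ⟨B, hB⟩ := half 0
    obtain ⟨G, hG⟩ := half 1
    have hBG : B ≠ G := by
      rintro rfl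
      obtain ⟨x, hx⟩ := hs B
      rcases Int.even_or_odd x with hx' | hx'
      · exact hB x (by simpa using hx') hx
      · exact hG x (hx'.sub_odd odd_one) hx
    obtain ⟨b, hb⟩ := hs B
    obtain ⟨g, hg⟩ := hs G
    have hbo : Odd b := by
      by_contra hcon
      exact hB b (by simpa using Int.not_odd_iff_even.mp hcon) hb
    have hge : Even g := by
      by_contra hcon
      exact hG g ((Int.not_even_iff_odd.mp hcon).sub_odd odd_one) hg
    obtain ⟨R, hRB, hRG⟩ : ∃ R, R ≠ B ∧ R ≠ G := by
      have : ∀ B G : Fin 3, B ≠ G → ∃ R, R ≠ B ∧ R ≠ G := by decide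
      exact this B G hBG
    have hE : ∀ x, Even x → c x = R ∨ c x = G := by
      intro x hx
      have := hB x (by simpa using hx)
      have := fin_three_cover R B G (c x) hRB hRG hBG
      grind
    have hO : ∀ x, Odd x → c x = R ∨ c x = B := by
      intro x hx
      have := hG x (hx.sub_odd odd_one)
      have := fin_three_cover R B G (c x) hRB hRG hBG
      grind
    have hdo : Odd (g - b) := hge.sub_odd hbo
    have hstep : ∀ d, Odd d → ∀ x y U, U ≠ R → (∀ z, Even (z - x) → c z = R ∨ c z = U) →
        c x = U → c y = R → Even (y - x) → ∃ i : ℕ, c (x + 2 * i * d) = U ∧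
          c (x + 2 * i * d + d + d) = R := by
      intro d hd x y U hU hcov hx hy hxy
      obtain ⟨t, ht⟩ := exists_eq_of_odd_step hp hd hxy
      obtain ⟨i, hi1, hi2⟩ := exists_step (φ := fun i : ℕ => c (x + 2 * i * d)) (t := t)
        (B := U) (R := R) (by simpa using hx) (ht.trans hy) hU
        (fun i => (hcov _ ⟨i * d, by ring⟩).symm)
      refine ⟨i, hi1, ?_⟩
      rw [← hi2]
      congr 1
      push_cast
      ring
    have hRodd : ∃ y, Odd y ∧ c y = R := by
      by_contra! hcon
      obtain ⟨r, hr⟩ := hs R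
      have hre : Even r := by
        by_contra hr'
        exact hcon r (Int.not_even_iff_odd.mp hr') hr
      obtain ⟨i, h1, h2⟩ := hstep 1 odd_one g r G hRG.symm
        (fun z hz => hE z (by simpa using hz.add hge)) hg hr (hre.sub hge)
      have hodd : Odd (g + 2 * i * 1 + 1) := by
        obtain ⟨k, rfl⟩ := hge
        exact ⟨k + i, by ring⟩
      have h3 := (hO _ hodd).resolve_left (hcon _ hodd)
      have := h (g + 2 * i * 1) (g + 2 * i * 1 + 1) (g + 2 * i * 1 + 1 + 1) (by ring)
      grind
    have hReven : ∃ y, Even y ∧ c y = R := by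
      by_contra! hcon
      obtain ⟨r, hr⟩ := hs R
      have hro : Odd r := by
        by_contra hr'
        exact hcon r (Int.not_odd_iff_even.mp hr') hr
      obtain ⟨i, h1, h2⟩ := hstep 1 odd_one b r B hRB.symm
        (fun z hz => hO z (by simpa using hz.add_odd hbo)) hb hr (hro.sub_odd hbo)
      have heven : Even (b + 2 * i * 1 + 1) := by
        obtain ⟨k, rfl⟩ := hbo
        exact ⟨k + i + 1, by ring⟩
      have h3 := (hE _ heven).resolve_left (hcon _ heven)
      have := h (b + 2 * i * 1) (b + 2 * i * 1 + 1) (b + 2 * i * 1 + 1 + 1) (by ring)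
      grind
    obtain ⟨ro, hro, hroR⟩ := hRodd
    obtain ⟨re, hre, hreR⟩ := hReven
    set d := g - b with hd
    obtain ⟨i, hi1, hi2⟩ := hstep d hdo b ro B hRB.symm
      (fun z hz => hO z (by simpa using hz.add_odd hbo)) hb hroR (hro.sub_odd hbo)
    obtain ⟨j, hj1, hj2⟩ := hstep d hdo g re G hRG.symm
      (fun z hz => hE z (by simpa using hz.add hge)) hg hreR (hre.sub hge)
    -- The midpoint of a B and an R is an even number, colored R or G, and G would be rainbow.
    have hi3 : c (b + 2 * i * d + d) = R := by
      have h1 := hE (b + 2 * i * d + d) (by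
        have : Even (2 * i * d) := ⟨i * d, by ring⟩
        exact (hbo.add_even this).add_odd hdo)
      have h2 := h (b + 2 * i * d) (b + 2 * i * d + d) (b + 2 * i * d + d + d) (by ring)
      grind
    have hj3 : c (g + 2 * j * d + d) = R := by
      have h1 := hO (g + 2 * j * d + d) (by
        have : Even (2 * j * d) := ⟨j * d, by ring⟩
        exact (hge.add this).add_odd hdo)
      have h2 := h (g + 2 * j * d) (g + 2 * j * d + d) (g + 2 * j * d + d + d) (by ring)
      grind
    have hper : Function.Periodic (fun i : ℤ => c (b + i • d)) ((2 ^ (a + 1) : ℕ) : ℤ) := by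
      intro i
      have := (hp.int_mul d) (b + i • d)
      simp only [zsmul_eq_mul, Int.cast_id] at this ⊢
      rw [← this]
      congr 1
      ring
    have e1 : Bichromatic (fun i : ℤ => c (b + i • d)) 0 R := by
      unfold Bichromatic
      simp only [zero_zsmul, zero_add, one_zsmul, add_zero, hd, add_sub_cancel, hb, hg]
      exact ⟨hBG, hRB.symm, hRG.symm⟩
    have e2 : Bichromatic (fun i : ℤ => c (b + i • d)) (2 * i) G := by
      unfold Bichromatic
      simp only [zsmul_eq_mul, Int.cast_id]
      rw [show b + (2 * (i : ℤ) + 1) * d = b + 2 * i * d + d by ring, hi3, hi1]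
      exact ⟨hRB.symm, hBG, hRG⟩
    have e3 : Bichromatic (fun i : ℤ => c (b + i • d)) (2 * j + 1) B := by
      unfold Bichromatic
      simp only [zsmul_eq_mul, Int.cast_id]
      rw [show b + (2 * (j : ℤ) + 1) * d = g + 2 * j * d by rw [hd]; ring,
        show b + (2 * (j : ℤ) + 1 + 1) * d = g + 2 * j * d + d by rw [hd]; ring, hj3, hj1]
      exact ⟨hRG.symm, hBG.symm, hRB⟩
    exact (h.progression b d).not_three_types (by positivity) hper hRG hRB hBG.symm e1 e2 e3

theorem isMaxColors_two_pow (a : ℕ) : IsMaxColors (2 ^ (a + 1)) 2 := by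
  have h2 : 2 ≤ 2 ^ (a + 1) := by
    have := Nat.one_le_two_pow (n := a)
    rw [pow_succ]; omega
  refine ⟨⟨_, periodic_ite_dvd _ 0 1, rainbowFree_of_two_colors _ _ _, ?_⟩, fun c hp h => ?_⟩
  · rw [range_ite_dvd h2]; simp
  · by_contra! hcon
    obtain ⟨f, hf⟩ := exists_surjective_comp (k := 3) (by norm_num) hcon
    exact not_surjective_of_periodic_two_pow _ _ (hp.comp f) (h.comp f) hf

/-! ### Upper bound for a product with an odd factor -/

/-- The set of colors on the residue class of `j` modulo `k`. -/
def classColors (c : ℤ → ℕ) (k j : ℤ) : Set ℕ := range fun t : ℤ => c (j + k * t)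

theorem mem_classColors_self (c : ℤ → ℕ) (k j : ℤ) : c j ∈ classColors c k j := ⟨0, by simp⟩

theorem classColors_add (c : ℤ → ℕ) (k j : ℤ) : classColors c k (j + k) = classColors c k j := by
  ext y
  constructor
  · rintro ⟨t, rfl⟩
    exact ⟨t + 1, by simp only; congr 1; ring⟩
  · rintro ⟨t, rfl⟩
    exact ⟨t - 1, by simp only; congr 1; ring⟩

/-- The periods of the coloring induced on the residue class of `j` modulo `k`. -/
def classPeriods (c : ℤ → ℕ) (k j : ℤ) : AddSubgroup ℤ where
  carrier := {s | ∀ t, c (j + k * (t + s)) = c (j + k * t)}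
  zero_mem' := by intro t; simp
  add_mem' := by
    intro a b ha hb t
    rw [← add_assoc, hb, ha]
  neg_mem' := by
    intro a ha t
    rw [← ha (t + -a), neg_add_cancel_right]

/-- Four is invertible modulo m: for m = 2t + 1, m² - 4(t² + t) = 1. -/
theorem mem_of_four_mul_mem {S : AddSubgroup ℤ} {m : ℕ} (hm : Odd m) (hS : (m : ℤ) ∈ S) {s : ℤ}
    (hs : 4 * s ∈ S) : s ∈ S := by
  obtain ⟨t, rfl⟩ := hm
  have h1 : (s * (2 * t + 1)) • ((2 * t + 1 : ℕ) : ℤ) ∈ S := S.zsmul_mem hS _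
  have h2 : (t ^ 2 + t : ℤ) • (4 * s) ∈ S := S.zsmul_mem hs _
  have := S.sub_mem h1 h2
  simp only [smul_eq_mul] at this
  push_cast at this
  convert this using 1
  ring

/-- Reflecting the points t and t + 2(b - a) of class j in a and b of class i reaches the same
point. Its color must come from each reflection's pair, and since the colors at a and b are distinct
and foreign to class j, the two points of class j agree. -/
theorem RainbowFree.two_mul_sub_mem_classPeriods {c : ℤ → ℕ} (h : RainbowFree c) {k i j a b : ℤ}
    (ha : c (i + k * a) ∉ classColors c k j) (hb : c (i + k * b) ∉ classColors c k j)
    (hab : c (i + k * a) ≠ c (i + k * b)) : 2 * (b - a) ∈ classPeriods c k j := by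
  intro t
  have m1 : c (j + k * t) ∈ classColors c k j := ⟨t, rfl⟩
  have m2 : c (j + k * (t + 2 * (b - a))) ∈ classColors c k j := ⟨_, rfl⟩
  have h1 := h (j + k * t) (i + k * a) (2 * i - j + k * (2 * a - t)) (by ring)
  have h2 := h (j + k * (t + 2 * (b - a))) (i + k * b) (2 * i - j + k * (2 * a - t)) (by ring)
  grind

/-- Among two residue classes, one has at most one color missing from the other. -/
theorem RainbowFree.ncard_diff_classColors {c : ℤ → ℕ} (h : RainbowFree c) {k m : ℕ} (hm : Odd m)
    (hp : Function.Periodic c ((k * m : ℕ) : ℤ)) {i j : ℤ}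
    (h1 : 1 < (classColors c k i \ classColors c k j).ncard)
    (h2 : 1 < (classColors c k j \ classColors c k i).ncard) : False := by
  rw [one_lt_ncard (finite_of_ncard_pos (by omega))] at h1 h2
  obtain ⟨_, ⟨⟨a, rfl⟩, ha⟩, _, ⟨⟨b, rfl⟩, hb⟩, hab⟩ := h1
  obtain ⟨_, ⟨⟨e, rfl⟩, he⟩, _, ⟨⟨f, rfl⟩, hf⟩, hef⟩ := h2
  have p1 := h.two_mul_sub_mem_classPeriods ha hb hab
  have p2 := h.two_mul_sub_mem_classPeriods he hf hef
  have ea : c (i + k * (a + 2 * (f - e))) = c (i + k * a) := p2 a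
  -- Moving a by the period 2(f - e) of class i keeps its color, so class j acquires a second period
  -- differing from the first by 4(f - e).
  have p3 := h.two_mul_sub_mem_classPeriods (a := a + 2 * (f - e)) (by rwa [ea]) hb (by rwa [ea])
  have p4 : 4 * (f - e) ∈ classPeriods c k j := by
    have := (classPeriods c k j).sub_mem p1 p3
    convert this using 1
    ring
  have hmS : (m : ℤ) ∈ classPeriods c k j := by
    intro t
    rw [← hp (j + k * t)]
    congr 1
    push_cast
    ring
  have p5 := mem_of_four_mul_mem hm hmS p4 e
  rw [add_sub_cancel] at p5
  exact hef p5.symm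

/-- Upper bound for the number of colors in terms of a subgroup of odd order and its quotient. -/
theorem RainbowFree.ncard_range_le {k m A B : ℕ} (hk : k ≠ 0) (hm : Odd m)
    (hA : ∀ c : ℤ → ℕ, Function.Periodic c (m : ℤ) → RainbowFree c → (range c).ncard ≤ A)
    (hB : ∀ c : ℤ → ℕ, Function.Periodic c (k : ℤ) → RainbowFree c → (range c).ncard ≤ B)
    {c : ℤ → ℕ} (h : RainbowFree c) (hp : Function.Periodic c ((k * m : ℕ) : ℤ)) :
    (range c).ncard ≤ A + (B - 1) := by
  classical
  have hfin : (range c).Finite := Periodic.finite_range (Nat.mul_ne_zero hk hm.pos.ne') hp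
  have hPfin : ∀ j, (classColors c k j).Finite := fun j =>
    hfin.subset (by rintro _ ⟨t, rfl⟩; exact ⟨_, rfl⟩)
  have hPA : ∀ j, (classColors c k j).ncard ≤ A := by
    intro j
    refine hA _ (fun t => ?_) ((h.comp_affine j (AddMonoidHom.mulLeft (k : ℤ))))
    have := hp (j + k * t)
    change c (j + k * (t + m)) = c (j + k * t)
    rw [← this]
    congr 1
    push_cast
    ring
  obtain ⟨j₀, hj₀⟩ : ∃ j₀, ∀ j, (classColors c k j).ncard ≤ (classColors c k j₀).ncard := by
    have hbdd : BddAbove (range fun j => (classColors c k j).ncard) :=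
      ⟨A, by rintro _ ⟨j, rfl⟩; exact hPA j⟩
    obtain ⟨j₀, hj⟩ := Nat.sSup_mem (range_nonempty _) hbdd
    refine ⟨j₀, fun j => ?_⟩
    simp only at hj
    rw [hj]
    exact le_csSup hbdd ⟨j, rfl⟩
  set P := classColors c k with hP
  have hdiff : ∀ j, (P j \ P j₀).ncard ≤ 1 := by
    intro j
    by_contra! hcon
    have := (ncard_le_ncard_iff_ncard_sdiff_le_ncard_sdiff (hPfin j) (hPfin j₀)).mp (hj₀ j)
    exact h.ncard_diff_classColors hm hp hcon (hcon.trans_le this)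
  -- The choice depends on the color set only, so `q` inherits the period k. Classes without a new
  -- color receive the default c j₀, which lies in P j₀.
  set Q : Set ℕ → ℕ := fun s => if hs : (s \ P j₀).Nonempty then hs.some else c j₀ with hQ
  set q : ℤ → ℕ := fun j => Q (P j) with hq
  have q1 : ∀ j, ∀ y ∈ P j, y = q j ∨ y ∈ P j₀ := by
    intro j y hy
    by_cases hy0 : y ∈ P j₀
    · exact Or.inr hy0
    have hne : (P j \ P j₀).Nonempty := ⟨y, hy, hy0⟩
    have hsome : q j = hne.some := by simp only [hq, hQ, dif_pos hne]
    left
    rw [hsome]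
    exact (ncard_le_one ((hPfin j).sdiff)).mp (hdiff j) _ ⟨hy, hy0⟩ _ hne.some_mem
  have q2 : ∀ j, q j = c j₀ ∨ (q j ∈ P j ∧ q j ∉ P j₀) := by
    intro j
    by_cases hne : (P j \ P j₀).Nonempty
    · right
      have hsome : q j = hne.some := by simp only [hq, hQ, dif_pos hne]
      rw [hsome]
      exact hne.some_mem
    · left
      simp only [hq, hQ, dif_neg hne]
  have qper : Function.Periodic q (k : ℤ) := by
    intro j
    simp only [hq, hP, classColors_add]
  have qRF : RainbowFree q := by
    intro x y z e
    by_contra! hcon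
    obtain ⟨hxy, hyz, hxz⟩ := hcon
    have mid : ∀ x y z : ℤ, x + z = y + y → (q x ∈ P x ∧ q x ∉ P j₀) → (q y ∈ P y ∧ q y ∉ P j₀) →
        q x ≠ q y → q x ≠ q z → q y ≠ q z → False := by
      rintro x y z e ⟨⟨a, ha⟩, hx0⟩ ⟨⟨b, hb⟩, hy0⟩ h1 h2 h3
      have hz : c (z + k * (2 * b - a)) ∈ P z := ⟨_, rfl⟩
      have := h (x + k * a) (y + k * b) (z + k * (2 * b - a)) (by linear_combination e)
      have := q1 z _ hz
      grind
    rcases q2 x with hx | hx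
    · have hy := (q2 y).resolve_left (fun hy => hxy (hx.trans hy.symm))
      have hz := (q2 z).resolve_left (fun hz => hxz (hx.trans hz.symm))
      exact mid z y x (by omega) hz hy hyz.symm hxz.symm hxy.symm
    rcases q2 z with hz | hz
    · have hy := (q2 y).resolve_left (fun hy => hyz (hy.trans hz.symm))
      exact mid x y z e hx hy hxy hxz hyz
    obtain ⟨⟨a, ha⟩, hx0⟩ := hx
    obtain ⟨⟨b, hb⟩, hz0⟩ := hz
    -- A midpoint requires a + b even; adding the odd period m to b corrects the parity.
    obtain ⟨b', hb', f, hf⟩ : ∃ b', c (z + k * b') = q z ∧ ∃ f, a + b' = f + f := by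
      rcases Int.even_or_odd (a + b) with hab | hab
      · exact ⟨b, hb, hab⟩
      · refine ⟨b + m, ?_, ?_⟩
        · rw [← hb]
          simp only
          rw [← hp (z + k * b)]
          congr 1
          push_cast
          ring
        · obtain ⟨f, hf⟩ := hab.add_odd ((Int.odd_coe_nat m).mpr hm)
          exact ⟨f, by rw [← hf]; ring⟩
    have hy : c (y + k * f) ∈ P y := ⟨_, rfl⟩
    have := h (x + k * a) (y + k * f) (z + k * b') (by linear_combination e + k * hf)
    have := q1 y _ hy
    grind
  have hsub : range c ⊆ P j₀ ∪ (range q \ {c j₀}) := by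
    rintro _ ⟨x, rfl⟩
    rcases q1 x _ (mem_classColors_self c k x) with hx | hx
    · by_cases h0 : c x = c j₀
      · left
        rw [h0]
        exact mem_classColors_self c k j₀
      · exact Or.inr ⟨⟨x, hx.symm⟩, h0⟩
    · exact Or.inl hx
  have hqfin := Periodic.finite_range hk qper
  have hmem : c j₀ ∈ range q := by
    refine ⟨j₀, ?_⟩
    rcases q2 j₀ with h0 | h0
    · exact h0
    · exact absurd h0.1 h0.2
  calc (range c).ncard ≤ (P j₀ ∪ (range q \ {c j₀})).ncard :=
        ncard_le_ncard hsub ((hPfin j₀).union hqfin.sdiff)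
    _ ≤ (P j₀).ncard + (range q \ {c j₀}).ncard := ncard_union_le _ _
    _ ≤ A + (B - 1) := by
        rw [ncard_sdiff_singleton_of_mem hmem]
        exact Nat.add_le_add (hPA j₀) (Nat.sub_le_sub_right (hB q qper qRF) 1)

/-! ### Lower bound for a product, and the two types of primes -/

/-- A rainbow-free coloring with period `n` and at least `k` colors, one of which occurs exactly at
the multiples of `n`. -/
def HasPointedColoring (n k : ℕ) : Prop :=
  ∃ c : ℤ → ℕ, Function.Periodic c (n : ℤ) ∧ RainbowFree c ∧ k ≤ (range c).ncard ∧
    ∀ x, c x = c 0 → (n : ℤ) ∣ x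

theorem IsMaxColors.mul {p m k l : ℕ} (hp : p.Prime) (hp2 : p ≠ 2) (hm : m ≠ 0)
    (h1 : IsMaxColors p k) (h1' : HasPointedColoring p k) (h2 : IsMaxColors m l) :
    IsMaxColors (p * m) (k + (l - 1)) := by
  have hpodd : Odd p := hp.odd_of_ne_two hp2
  refine ⟨?_, fun c hc hRF => RainbowFree.ncard_range_le hm hpodd h1.2 h2.2 hRF (by
    rwa [mul_comm m p])⟩
  obtain ⟨c₁, hc₁p, hc₁, hcard₁, hpt⟩ := h1'
  obtain ⟨⟨c₀, hc₀p, hc₀, hcard₀⟩, -⟩ := h2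
  have hpz : (p : ℤ) ≠ 0 := by exact_mod_cast hp.ne_zero
  have hdvd : ∀ x, (p : ℤ) ∣ x ↔ c₁ x = c₁ 0 := by
    refine fun x => ⟨?_, hpt x⟩
    rintro ⟨y, rfl⟩
    rw [mul_comm]
    simpa using hc₁p.int_mul_eq y
  -- Even and odd values keep the two palettes disjoint.
  set c : ℤ → ℕ := fun x => if (p : ℤ) ∣ x then 2 * c₀ (x / p) else 2 * c₁ x + 1 with hc
  have cp : Function.Periodic c ((p * m : ℕ) : ℤ) := by
    intro x
    have e1 : (p : ℤ) ∣ x + ((p * m : ℕ) : ℤ) ↔ (p : ℤ) ∣ x := by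
      push_cast
      exact dvd_add_left (dvd_mul_right _ _)
    have e2 : c₁ (x + ((p * m : ℕ) : ℤ)) = c₁ x := by
      have := hc₁p.int_mul m x
      rw [← this]
      congr 1
      push_cast
      ring
    simp only [hc, e1, e2]
    split_ifs with hx
    · obtain ⟨y, rfl⟩ := hx
      push_cast
      rw [← mul_add, Int.mul_ediv_cancel_left _ hpz, Int.mul_ediv_cancel_left _ hpz, hc₀p]
    · rfl
  have cRF : RainbowFree c := by
    intro x y z e
    by_cases hall : (p : ℤ) ∣ x ∧ (p : ℤ) ∣ y ∧ (p : ℤ) ∣ z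
    · obtain ⟨⟨x, rfl⟩, ⟨y, rfl⟩, ⟨z, rfl⟩⟩ := hall
      simp only [hc, dvd_mul_right, if_true, Int.mul_ediv_cancel_left _ hpz]
      have := hc₀ x y z (mul_left_cancel₀ hpz (by linear_combination e))
      omega
    -- Two multiples of p force the third, p being odd. So at most one term is a multiple, and the
    -- equal pair for c₁ consists of non-multiples.
    · have hxy : (p : ℤ) ∣ x → (p : ℤ) ∣ y → (p : ℤ) ∣ z := by
        intro a b
        have : z = y + y - x := by omega
        rw [this]
        exact dvd_sub (dvd_add b b) a
      have hyz : (p : ℤ) ∣ y → (p : ℤ) ∣ z → (p : ℤ) ∣ x := by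
        intro a b
        have : x = y + y - z := by omega
        rw [this]
        exact dvd_sub (dvd_add a a) b
      have hxz : (p : ℤ) ∣ x → (p : ℤ) ∣ z → (p : ℤ) ∣ y := by
        intro a b
        have h2y : (p : ℤ) ∣ 2 * y := by
          rw [two_mul, ← e]
          exact dvd_add a b
        rcases (Nat.prime_iff_prime_int.mp hp).dvd_or_dvd h2y with h2 | h2
        · have : p ∣ 2 := by exact_mod_cast h2
          exact absurd ((Nat.prime_dvd_prime_iff_eq hp Nat.prime_two).mp this) hp2
        · exact h2
      have := hc₁ x y z e
      have := hdvd x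
      have := hdvd y
      have := hdvd z
      simp only [hc]
      split_ifs <;> grind
  refine ⟨c, cp, cRF, ?_⟩
  have hrange : (fun y => 2 * y) '' range c₀ ∪ (fun y => 2 * y + 1) '' (range c₁ \ {c₁ 0}) ⊆
      range c := by
    rintro _ (⟨_, ⟨x, rfl⟩, rfl⟩ | ⟨_, ⟨⟨x, rfl⟩, hx⟩, rfl⟩)
    · exact ⟨p * x, by simp [hc, Int.mul_ediv_cancel_left _ hpz]⟩
    · refine ⟨x, ?_⟩
      have : ¬ (p : ℤ) ∣ x := fun h => hx ((hdvd x).mp h)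
      simp [hc, this]
  have f0 := Periodic.finite_range hm hc₀p
  have f1 := Periodic.finite_range hp.ne_zero hc₁p
  have hle := ncard_le_ncard hrange (Periodic.finite_range (Nat.mul_ne_zero hp.ne_zero hm) cp)
  rw [ncard_union_eq ?_ (f0.image _) (f1.sdiff.image _),
    ncard_image_of_injective _ (fun a b h => by simpa using h),
    ncard_image_of_injective _ (fun a b h => by simpa using h),
    ncard_sdiff_singleton_of_mem (mem_range_self 0)] at hle
  · have : 0 < (range c₁).ncard := (ncard_pos f1).mpr (range_nonempty _)
    have : 0 < (range c₀).ncard := (ncard_pos f0).mpr (range_nonempty _)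
    omega
  · rw [disjoint_left]
    rintro _ ⟨a, -, rfl⟩ ⟨b, -, hb⟩
    simp only at hb
    omega

/-- Translating the point whose color is used once to 0 makes the coloring pointed. -/
theorem isMaxColors_three_of_surjective {p : ℕ} [hp : Fact p.Prime] {c : ZMod p → Fin 3}
    (h : RainbowFree c) (hs : Function.Surjective c) :
    IsMaxColors p 3 ∧ HasPointedColoring p 3 := by
  obtain ⟨a, ha⟩ := h.exists_singleton hs
  have hRF : RainbowFree (fun i : ℤ => (c (a + i) : ℕ)) :=
    (h.comp_affine a (Int.castAddHom (ZMod p))).comp Fin.val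
  have hper : Function.Periodic (fun i : ℤ => (c (a + i) : ℕ)) (p : ℤ) := by
    intro i
    simp
  have hcard : 3 ≤ (range (fun i : ℤ => (c (a + i) : ℕ))).ncard := by
    refine le_ncard_range_of_surjective (Periodic.finite_range hp.out.ne_zero hper)
      (f := Fin.ofNat 3) fun i => ?_
    obtain ⟨x, rfl⟩ := hs i
    obtain ⟨j, hj⟩ := ZMod.intCast_surjective (x - a)
    exact ⟨j, by simp [hj]⟩
  refine ⟨⟨⟨_, hper, hRF, hcard⟩, fun g hgp hg => ?_⟩, _, hper, hRF, hcard, fun x hx => ?_⟩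
  · by_contra! hcon
    obtain ⟨f, hf⟩ := exists_surjective_comp (k := 4) (by norm_num) hcon
    obtain ⟨c', hc', e⟩ := Periodic.exists_zmod (hgp.comp f) (hg.comp f)
    refine hc'.not_surjective_fin_four fun i => ?_
    obtain ⟨x, hx⟩ := hf i
    exact ⟨x, (e x).trans hx⟩
  · have := ha (a + x) (by simpa [Fin.val_inj] using hx)
    rw [add_eq_left] at this
    exact (ZMod.intCast_zmod_eq_zero_iff_dvd _ _).mp this

theorem isMaxColors_two_of_not_surjective {p : ℕ} (hp : p.Prime)
    (h : ∀ c : ZMod p → Fin 3, RainbowFree c → ¬ Function.Surjective c) :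
    IsMaxColors p 2 ∧ HasPointedColoring p 2 := by
  have hcard : 2 ≤ (range (fun x : ℤ => if (p : ℤ) ∣ x then 0 else 1)).ncard := by
    rw [range_ite_dvd hp.two_le]; simp
  refine ⟨⟨⟨_, periodic_ite_dvd _ 0 1, rainbowFree_of_two_colors _ _ _, hcard⟩,
    fun g hgp hg => ?_⟩, _, periodic_ite_dvd _ 0 1, rainbowFree_of_two_colors _ _ _, hcard,
    fun x hx => ?_⟩
  · by_contra! hcon
    obtain ⟨f, hf⟩ := exists_surjective_comp (k := 3) (by norm_num) hcon
    obtain ⟨c', hc', e⟩ := Periodic.exists_zmod (hgp.comp f) (hg.comp f)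
    refine h c' hc' fun i => ?_
    obtain ⟨x, hx⟩ := hf i
    exact ⟨x, (e x).trans hx⟩
  · simpa using hx

/-! ### The formula for general n -/

/-- An odd prime is of one of two types, determined by its anti-van der Waerden number. -/
theorem prime_awZ_cases {p : ℕ} (hp : p.Prime) :
    (awZ p 3 = 3 ∧ IsMaxColors p 2 ∧ HasPointedColoring p 2 ∧
      ∀ c : ZMod p → Fin 3, RainbowFree c → ¬ Function.Surjective c) ∨
    (awZ p 3 = 4 ∧ IsMaxColors p 3 ∧ HasPointedColoring p 3 ∧
      ∃ c : ZMod p → Fin 3, RainbowFree c ∧ Function.Surjective c) := by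
  have : Fact p.Prime := ⟨hp⟩
  by_cases h : ∃ c : ZMod p → Fin 3, RainbowFree c ∧ Function.Surjective c
  · obtain ⟨c, hc, hs⟩ := h
    obtain ⟨h1, h2⟩ := isMaxColors_three_of_surjective hc hs
    exact Or.inr ⟨awZ_eq_of_isMaxColors hp.ne_zero h1, h1, h2, c, hc, hs⟩
  · push Not at h
    obtain ⟨h1, h2⟩ := isMaxColors_two_of_not_surjective hp h
    exact Or.inl ⟨awZ_eq_of_isMaxColors hp.ne_zero h1, h1, h2, h⟩

theorem f₂_prime_mul {p m : ℕ} (hp : Odd p) : f₂ (p * m) = f₂ m := by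
  have : Even (p * m) ↔ Even m := by
    rw [Nat.even_mul]
    exact or_iff_right (Nat.not_even_iff_odd.mpr hp)
  simp [f₂, this]

theorem countP_primeFactorsList_mul (q : ℕ → Prop) [DecidablePred q] {p m : ℕ} (hp : p.Prime)
    (hm : m ≠ 0) : (p * m).primeFactorsList.countP (fun x => q x) =
      (if q p then 1 else 0) + m.primeFactorsList.countP (fun x => q x) := by
  rw [(Nat.perm_primeFactorsList_mul hp.ne_zero hm).countP_eq, List.countP_append,
    Nat.primeFactorsList_prime hp, List.countP_singleton]
  simp

theorem countP_primeFactorsList_two_pow (q : ℕ → Prop) [DecidablePred q] (a : ℕ) :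
    (2 ^ a).primeFactorsList.countP (fun x => Odd x ∧ q x) = 0 := by
  rw [List.countP_eq_zero]
  intro x hx
  rw [Nat.prime_two.primeFactorsList_pow] at hx
  obtain rfl := List.eq_of_mem_replicate hx
  simp [show ¬ Odd 2 by decide]

/-- Stripping an odd prime lowers the maximum by 1 or 2, the weights of `f₃` and `f₄`; a power of
two remains, where n = 1 must be allowed. -/
theorem isMaxColors_formula (n : ℕ) : n ≠ 0 → IsMaxColors n (1 + f₂ n + f₃ n + 2 * f₄ n) := by
  induction n using Nat.strong_induction_on with
  | _ n ih =>
    intro hn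
    by_cases hex : ∃ p, p.Prime ∧ p ≠ 2 ∧ p ∣ n
    · obtain ⟨p, hp, hp2, m, rfl⟩ := hex
      have hm : m ≠ 0 := by rintro rfl; simp at hn
      have hlt : m < p * m := by
        have := hp.two_le
        nlinarith [Nat.pos_of_ne_zero hm]
      have hpo := hp.odd_of_ne_two hp2
      have h := ih m hlt hm
      have e3 : f₃ (p * m) = (if Odd p ∧ awZ p 3 = 3 then 1 else 0) + f₃ m :=
        countP_primeFactorsList_mul (fun p => Odd p ∧ awZ p 3 = 3) hp hm
      have e4 : f₄ (p * m) = (if Odd p ∧ awZ p 3 = 4 then 1 else 0) + f₄ m :=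
        countP_primeFactorsList_mul (fun p => Odd p ∧ awZ p 3 = 4) hp hm
      rw [f₂_prime_mul hpo, e3, e4]
      rcases prime_awZ_cases hp with ⟨ha, h1, h2, -⟩ | ⟨ha, h1, h2, -⟩
      · convert IsMaxColors.mul hp hp2 hm h1 h2 h using 1
        simp only [ha, hpo]
        norm_num
        omega
      · convert IsMaxColors.mul hp hp2 hm h1 h2 h using 1
        simp only [ha, hpo]
        norm_num
        omega
    · push Not at hex
      obtain ⟨a, rfl⟩ : ∃ a, n = 2 ^ a :=
        ⟨_, Nat.eq_prime_pow_of_unique_prime_dvd hn fun {d} hd hdn => by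
          by_contra h2
          exact hex d hd h2 hdn⟩
      have e3 : f₃ (2 ^ a) = 0 := countP_primeFactorsList_two_pow _ a
      have e4 : f₄ (2 ^ a) = 0 := countP_primeFactorsList_two_pow _ a
      rw [e3, e4]
      rcases a with _ | a
      · simpa [f₂] using isMaxColors_one
      · have : f₂ (2 ^ (a + 1)) = 1 := by simp [f₂, pow_succ]
        rw [this]
        exact isMaxColors_two_pow a

theorem awZ_formula {n : ℕ} (hn : n ≠ 0) : awZ n 3 = 2 + f₂ n + f₃ n + 2 * f₄ n := by
  rw [awZ_eq_of_isMaxColors hn (isMaxColors_formula n hn)]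
  ring

/-! ### Powers of two as residues, and the primes below 100 -/

/-- If every nonzero residue is plus or minus a power of two, there is no rainbow-free coloring with
exactly three colors. -/
theorem RainbowFree.not_surjective_of_forall_two_pow {p : ℕ} [Fact p.Prime] (hp : p ≠ 2)
    (hgen : ∀ x : ZMod p, x ≠ 0 → ∃ i : ℕ, x = 2 ^ i ∨ x = -2 ^ i) {c : ZMod p → Fin 3}
    (h : RainbowFree c) : ¬ Function.Surjective c := by
  intro hs
  obtain ⟨a, ha⟩ := h.exists_singleton hs
  have hne : ∀ x, x ≠ 0 → c (a + x) ≠ c a := fun x hx e => hx (by simpa using ha _ e)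
  have h2 := two_ne_zero_of_ne_two hp
  have hdouble : ∀ x, x ≠ 0 → c (a + 2 * x) = c (a + x) := by
    intro x hx
    have h1 := h a (a + x) (a + 2 * x) (by ring)
    have := hne x hx
    have := hne (2 * x) (mul_ne_zero h2 hx)
    grind
  have hneg : ∀ x, x ≠ 0 → c (a + -x) = c (a + x) := by
    intro x hx
    have h1 := h (a + -x) a (a + x) (by ring)
    have := hne x hx
    have := hne (-x) (neg_ne_zero.mpr hx)
    grind
  have hpow : ∀ i : ℕ, c (a + 2 ^ i) = c (a + 1) := by
    intro i
    induction i with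
    | zero => simp
    | succ i ih => rw [pow_succ', hdouble _ (pow_ne_zero _ h2), ih]
  have hall : ∀ y, c y = c a ∨ c y = c (a + 1) := by
    intro y
    rcases eq_or_ne y a with rfl | hy
    · exact Or.inl rfl
    right
    obtain ⟨i, hi | hi⟩ := hgen (y - a) (sub_ne_zero.mpr hy)
    · rw [← hpow i, ← hi, add_sub_cancel]
    · rw [← hpow i, ← hneg _ (pow_ne_zero _ h2), ← hi, add_sub_cancel]
  obtain ⟨x, hx⟩ := hs 0
  obtain ⟨y, hy⟩ := hs 1
  obtain ⟨z, hz⟩ := hs 2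
  have := hall x
  have := hall y
  have := hall z
  grind

/-- A proper subgroup of the units containing `2` and `-1` yields a rainbow-free coloring. -/
theorem exists_rainbowFree_of_pow {p : ℕ} [Fact p.Prime] (hp : p ≠ 2) {e : ℕ} (he : Even e)
    (h2 : (2 : ZMod p) ^ e = 1) {x₀ : ZMod p} (hx₀ : x₀ ≠ 0) (hx₀e : x₀ ^ e ≠ 1) :
    ∃ c : ZMod p → Fin 3, RainbowFree c ∧ Function.Surjective c := by
  refine ⟨fun x => if x = 0 then 0 else if x ^ e = 1 then 1 else 2, ?_, ?_⟩
  · intro x y z hxyz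
    have hdouble : ∀ x : ZMod p, (2 * x) ^ e = 1 ↔ x ^ e = 1 := by
      intro x
      rw [mul_pow, h2, one_mul]
    have hneg : ∀ x : ZMod p, (-x) ^ e = 1 ↔ x ^ e = 1 := by
      intro x
      rw [he.neg_pow]
    by_cases hx : x = 0
    · subst hx
      have : z = 2 * y := by linear_combination hxyz
      subst this
      have := hdouble y
      have := mul_eq_zero (a := (2 : ZMod p)) (b := y)
      have := two_ne_zero_of_ne_two hp
      grind
    by_cases hy : y = 0
    · subst hy
      have : z = -x := by linear_combination hxyz
      subst this
      have := hneg x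
      grind
    by_cases hz : z = 0
    · subst hz
      have : x = 2 * y := by linear_combination hxyz
      subst this
      have := hdouble y
      grind
    grind
  · intro i
    have he0 : e ≠ 0 := by rintro rfl; simp at hx₀e
    fin_cases i
    · exact ⟨0, by simp⟩
    · exact ⟨1, by simp⟩
    · exact ⟨x₀, by simp [hx₀, hx₀e]⟩

/-- An even e with 2 ^ e = 1 puts 2 and -1 into the subgroup x ^ e = 1, and the witness x shows that
it is proper. -/
theorem exists_pow_of_mem_Q₄ : ∀ p ∈ Q₄, p ≠ 2 ∧ ∃ e ∈ Finset.range p, e % 2 = 0 ∧ 2 ^ e % p = 1 ∧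
    ∃ x ∈ Finset.range p, x ≠ 0 ∧ x ^ e % p ≠ 1 := by
  decide +kernel

theorem forall_two_pow_of_not_mem_Q₄ : ∀ p ∈ Finset.range 100, p.Prime → p ≠ 2 → p ∉ Q₄ →
    ∀ x ∈ Finset.range p, x ≠ 0 → ∃ i ∈ Finset.range p, 2 ^ i % p = x ∨ (x + 2 ^ i) % p = 0 := by
  decide +kernel

theorem awZ_eq_four_iff_mem_Q₄ {p : ℕ} (hp : p.Prime) (hp100 : p < 100) :
    awZ p 3 = 4 ↔ p ∈ Q₄ := by
  have : Fact p.Prime := ⟨hp⟩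
  constructor
  · intro h4
    by_contra hQ
    rcases eq_or_ne p 2 with rfl | hp2
    · have := awZ_eq_of_isMaxColors (by norm_num) (isMaxColors_two_pow 0)
      rw [zero_add, pow_one, h4] at this
      omega
    rcases prime_awZ_cases hp with ⟨h3, -⟩ | ⟨-, -, -, c, hc, hs⟩
    · omega
    refine hc.not_surjective_of_forall_two_pow hp2 (fun x hx => ?_) hs
    obtain ⟨i, -, hi⟩ := forall_two_pow_of_not_mem_Q₄ p (Finset.mem_range.mpr hp100) hp hp2 hQ x.val
      (Finset.mem_range.mpr (ZMod.val_lt x)) (by rwa [Ne, ZMod.val_eq_zero])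
    refine ⟨i, hi.imp (fun hi => ?_) (fun hi => ?_)⟩
    · rw [← ZMod.natCast_zmod_val x, ← hi, ZMod.natCast_mod]
      push_cast
      rfl
    · have := (ZMod.natCast_eq_zero_iff _ _).mpr (Nat.dvd_of_mod_eq_zero hi)
      push_cast [ZMod.natCast_zmod_val] at this
      exact eq_neg_of_add_eq_zero_left this
  · intro hQ
    obtain ⟨hp2, e, -, he, h2, x, hxp, hx0, hxe⟩ := exists_pow_of_mem_Q₄ p hQ
    have hlt : 1 < p := hp.one_lt
    have cast_one : ∀ y : ℕ, (y : ZMod p) = 1 ↔ y % p = 1 := by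
      intro y
      rw [← Nat.cast_one, ZMod.natCast_eq_natCast_iff', Nat.mod_eq_of_lt hlt]
    have h := exists_rainbowFree_of_pow (p := p) hp2 (e := e) (x₀ := x) (Nat.even_iff.mpr he)
      (by have := (cast_one (2 ^ e)).mpr h2; push_cast at this; exact this)
      (by
        rw [Ne, ZMod.natCast_eq_zero_iff]
        exact fun hd => absurd (Nat.le_of_dvd (by omega) hd) (by simpa using hxp))
      (by
        intro h
        exact hxe ((cast_one _).mp (by push_cast; exact h)))
    rcases prime_awZ_cases hp with ⟨-, -, -, h3⟩ | ⟨h4, -⟩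
    · obtain ⟨c, hc, hs⟩ := h
      exact absurd hs (h3 c hc)
    · exact h4

end AntiVdW

theorem theorem4 :
    (∀ p : ℕ, p.Prime → 3 ≤ AntiVdW.awZ p 3 ∧ AntiVdW.awZ p 3 ≤ 4) ∧
    (∀ n : ℕ, 2 ≤ n →
      AntiVdW.awZ n 3 = 2 + AntiVdW.f₂ n + AntiVdW.f₃ n + 2 * AntiVdW.f₄ n) ∧
    (∀ p : ℕ, p.Prime → p < 100 → (AntiVdW.awZ p 3 = 4 ↔ p ∈ AntiVdW.Q₄)) ∧
    (∀ n : ℕ, 2 ≤ n → (∀ p : ℕ, p.Prime → p ∣ n → p < 100) →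
      AntiVdW.f₄ n = n.primeFactorsList.countP (fun p => Odd p ∧ p ∈ AntiVdW.Q₄) ∧
      AntiVdW.f₃ n = n.primeFactorsList.countP (fun p => Odd p ∧ p ∈ AntiVdW.Q₃)) := by
  have bounds : ∀ p : ℕ, p.Prime → AntiVdW.awZ p 3 = 3 ∨ AntiVdW.awZ p 3 = 4 := fun p hp =>
    (AntiVdW.prime_awZ_cases hp).imp And.left And.left
  refine ⟨fun p hp => by rcases bounds p hp with h | h <;> omega,
    fun n hn => AntiVdW.awZ_formula (by omega),
    fun p hp hp100 => AntiVdW.awZ_eq_four_iff_mem_Q₄ hp hp100, fun n _ hfac => ⟨?_, ?_⟩⟩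
  · refine List.countP_congr fun p hp => ?_
    have hpp := Nat.prime_of_mem_primeFactorsList hp
    have := AntiVdW.awZ_eq_four_iff_mem_Q₄ hpp (hfac p hpp (Nat.dvd_of_mem_primeFactorsList hp))
    simp [this]
  · refine List.countP_congr fun p hp => ?_
    have hpp := Nat.prime_of_mem_primeFactorsList hp
    have hlt := hfac p hpp (Nat.dvd_of_mem_primeFactorsList hp)
    have h4 := AntiVdW.awZ_eq_four_iff_mem_Q₄ hpp hlt
    have h3 : AntiVdW.awZ p 3 = 3 ↔ p ∉ AntiVdW.Q₄ := by
      rw [← h4]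
      rcases bounds p hpp with h | h <;> omega
    simp only [AntiVdW.Q₃, Finset.mem_filter, Finset.mem_range, decide_eq_true_eq]
    tauto
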